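/- Let $S^3=\{(x,y,z,w)\in\mathbb R^4: x^2+y^2+z^2+w^2=1\}$ be the round three-sphere, with the vector fields $$E_1=\tfrac12(w\partial_x-z\partial_y+y\partial_z-x\partial_w),\quad E_2=\tfrac12(z\partial_x+w\partial_y-x\partial_z-y\partial_w),\quad E_3=\tfrac12(-y\partial_x+x\partial_y+w\partial_z-z\partial_w),$$ and let $\pi:S^3\to S^2$ be the Hopf map onto the unit sphere $S^2\subset\mathbb R^3$ whose fibres are the orbits of the Hopf field $E_1$, $$\pi(x,y,z,w)=\bigl(w^2+x^2-y^2-z^2,\;2(xy-wz),\;2(xz+wy)\bigr),\qquad \pi^*f=f\circ\pi .$$ All functions and vector fields are smooth. Let $\mathfrak X_\mu(S^n)$ be the Lie algebra of divergence-free vector fields on the round unit sphere $S^n$, with the commutator of vector fields, and let $\mathfrak X^1_\mu(S^3)=\{u\in\mathfrak X_\mu(S^3):[E_1,u]=0\}$, which is a Lie subalgebra. On $S^2$ let $\{f,h\}$ be the Poisson bracket, $\{f,h\}\mu=df\wedge dh$ with $\mu$ the area form (outward orientation), and let $X_\psi(p)=p\times\nabla\psi(p)$ be the Hamiltonian vector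 field with stream function $\psi\in C^\infty(S^2)$. Then: 1. A vector field on $S^2$ is divergence-free if and only if it equals $X_\psi$ for some $\psi\in C^\infty(S^2)$. The Lie algebra $\mathfrak X_\mu(S^2)$ acts on $C^\infty(S^2)$ by derivatives along vector fields, and $\rho(X_\psi)\sigma=\{\psi,\sigma\}$. 2. The pullback $\pi^*$ is injective on $C^\infty(S^2)$, and its image is the set of $\tilde f\in C^\infty(S^3)$ with $E_1\tilde f=0$. 3. A vector field $u$ on $S^3$ belongs to $\mathfrak X^1_\mu(S^3)$ if and only if $$u=\tilde\sigma E_1-(E_3\tilde\psi)E_2+(E_2\tilde\psi)E_3\qquad\text{for some }\tilde\sigma,\tilde\psi\in C^\infty(S^3)\text{ with }E_1\tilde\sigma=E_1\tilde\psi=0. $$ 4. The formula $b(X_{\psi_1},X_{\psi_2})=-\{\psi_1,\psi_2\}$ defines a 2-cocycle on $\mathfrak X_\mu(S^2)$ with values in the module $C^\infty(S^2)$, and the Lie algebra $\mathfrak X^1_\mu(S^3)$ is isomorphic to the Abelian extension $\mathfrak X_\mu(S^2)\times C^\infty(S^2)$ with bracket $$[(v_1,\sigma_1),(v_2,\sigma_2)]=\bigl([v_1,v_2],\;\rho(v_1)\sigma_2-\rho(v_2)\sigma_1+b(v_1,v_2)\bigr).$$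 There is an isomorphism under which $u\in\mathfrak X^1_\mu(S^3)$ corresponds to $(X_\psi,\sigma)$ if and only if $u=(\pi^*\sigma)E_1-(E_3\pi^*\psi)E_2+(E_2\pi^*\psi)E_3$. -/

import Mathlib

open scoped Manifold ContDiff InnerProductSpace Gradient

noncomputable section

namespace SphereFlow

/-- Euclidean space `ℝⁿ⁺¹`. -/
abbrev Amb (n : ℕ) := EuclideanSpace ℝ (Fin (n + 1))

/-- The unit sphere `Sⁿ ⊂ ℝⁿ⁺¹`, with Mathlib's smooth structure. -/
abbrev Sph (n : ℕ) := Metric.sphere (0 : Amb n) 1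

/-- The algebra `C^∞(Sⁿ)` of smooth real functions. -/
abbrev SmoothFun (n : ℕ) := C^∞⟮𝓡 n, Sph n; ℝ⟯

/-- The extension `y ↦ f (y / |y|)` of a map on `Sⁿ` to `ℝⁿ⁺¹ ∖ {0}` (with value `0` at `0`).
It is constant along rays, so for `p ∈ Sⁿ` and `v ⟂ p` the number `fderiv ℝ (radialExt f) p v` is
the intrinsic derivative of `f` at `p` in the direction `v`, and the radial derivative is zero. -/
def radialExt {n : ℕ} {F : Type*} [NormedAddCommGroup F] (f : Sph n → F) (y : Amb n) : F :=
  if h : y = 0 then 0 else f ⟨‖y‖⁻¹ • y, by simp [norm_smul, h]⟩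

section basic

theorem two_le_smooth : (2 : WithTop ℕ∞) ≤ ∞ :=
  WithTop.coe_le_coe.2 (le_top : (2 : ℕ∞) ≤ ⊤)

theorem coe_ne_zero {n : ℕ} (p : Sph n) : (p : Amb n) ≠ 0 := by
  intro h
  have hp : ‖(p : Amb n)‖ = 1 := by simp
  simp [h] at hp

theorem radialExt_coe {n : ℕ} {F : Type*} [NormedAddCommGroup F] (f : Sph n → F) (p : Sph n) :
    radialExt f (p : Amb n) = f p := by
  have hp : ‖(p : Amb n)‖ = 1 := by simp
  simp only [radialExt, coe_ne_zero p, dite_false]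
  congr 1
  ext1
  simp [hp]

theorem exists_radial {n : ℕ} (F : Type*) [NormedAddCommGroup F] {y : Amb n} (hy : y ≠ 0) :
    ∃ p : Sph n, (p : Amb n) = ‖y‖⁻¹ • y ∧ ∀ f : Sph n → F, radialExt f y = f p :=
  ⟨⟨‖y‖⁻¹ • y, by simp [norm_smul, hy]⟩, rfl, fun f => by simp [radialExt, hy]⟩

theorem radialExt_smul {n : ℕ} {F : Type*} [NormedAddCommGroup F] (f : Sph n → F) {c : ℝ}
    (hc : 0 < c) (y : Amb n) : radialExt f (c • y) = radialExt f y := by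
  by_cases hy : y = 0
  · simp [hy]
  · have : c • y ≠ 0 := smul_ne_zero hc.ne' hy
    simp only [radialExt, hy, this, dite_false]
    congr 2
    rw [norm_smul, Real.norm_of_nonneg hc.le, smul_smul]
    congr 1
    field_simp

variable {n : ℕ} {F : Type*} [NormedAddCommGroup F] [NormedSpace ℝ F]

theorem contDiffAt_radialExt {f : Sph n → F} (hf : ContMDiff (𝓡 n) 𝓘(ℝ, F) ∞ f) {y : Amb n}
    (hy : y ≠ 0) : ContDiffAt ℝ ∞ (radialExt f) y := by
  have := Fact.mk (@finrank_euclideanSpace_fin ℝ _ (n + 1))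
  let U : TopologicalSpace.Opens (Amb n) := ⟨{0}ᶜ, isOpen_compl_singleton⟩
  have h1 : ContMDiff 𝓘(ℝ, Amb n) 𝓘(ℝ, Amb n) ∞ (fun x : U => ‖(x : Amb n)‖⁻¹ • (x : Amb n)) := by
    intro x
    have hx : (x : Amb n) ≠ 0 := x.2
    refine (contMDiffAt_subtype_iff (U := U) (f := fun x : Amb n => ‖x‖⁻¹ • x)).2 ?_
    exact (((contDiffAt_norm ℝ hx).inv (by simpa using hx)).smul contDiffAt_id).contMDiffAt
  have h2 := hf.comp (h1.codRestrict_sphere (n := n) (fun x => by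
    have hx : (x : Amb n) ≠ 0 := x.2
    simp [norm_smul, hx]))
  have h3 : ContMDiffAt 𝓘(ℝ, Amb n) 𝓘(ℝ, F) ∞ (fun x : U => radialExt f (x : Amb n)) ⟨y, hy⟩ := by
    refine (h2 ⟨y, hy⟩).congr_of_eventuallyEq (Filter.Eventually.of_forall fun x => ?_)
    have hx : (x : Amb n) ≠ 0 := x.2
    simp [radialExt, hx]
    rfl
  exact (contMDiffAt_subtype_iff.1 h3).contDiffAt

theorem contMDiff_restrict {g : Amb n → F} (hg : ∀ y, y ≠ 0 → ContDiffAt ℝ ∞ g y) :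
    ContMDiff (𝓡 n) 𝓘(ℝ, F) ∞ (fun p : Sph n => g p) := fun p =>
  have := Fact.mk (@finrank_euclideanSpace_fin ℝ _ (n + 1))
  ((hg p (coe_ne_zero p)).contMDiffAt).comp p (contMDiff_coe_sphere p)

theorem fderiv_radialExt_smul (f : Sph n → F) {c : ℝ} (hc : 0 < c) (y : Amb n) :
    fderiv ℝ (radialExt f) (c • y) = c⁻¹ • fderiv ℝ (radialExt f) y := by
  have h : (fun x => radialExt f (c • x)) = radialExt f := by
    ext x; exact radialExt_smul f hc x
  have h2 := fderiv_comp_smul (𝕜 := ℝ) (f := radialExt f) (c := c) (x := y)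
  rw [h] at h2
  rw [h2, smul_smul, inv_mul_cancel₀ hc.ne', one_smul]

theorem fderiv_eq_of_norm_smul (p : Sph n) {g h : Amb n → F} (hg : DifferentiableAt ℝ g p)
    (hh : ∀ y, y ≠ 0 → h y = ‖y‖ • g y) (v : Amb n) :
    fderiv ℝ h p v = fderiv ℝ g p v + ⟪(p : Amb n), v⟫_ℝ • g p := by
  have hp : ‖(p : Amb n)‖ = 1 := by simp
  have h0 := coe_ne_zero p
  have e : h =ᶠ[nhds (p : Amb n)] fun y => ‖y‖ • g y := by
    filter_upwards [isOpen_ne.mem_nhds h0] with y hy using hh y hy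
  have hn : DifferentiableAt ℝ (fun y : Amb n => ‖y‖) p :=
    (contDiffAt_norm (n := 1) ℝ h0).differentiableAt (by simp)
  have hd : fderiv ℝ (fun y : Amb n => ‖y‖) p v = ⟪(p : Amb n), v⟫_ℝ := by
    have h1 := (hasStrictFDerivAt_norm_sq (p : Amb n)).hasFDerivAt
    have h2 := (hn.hasFDerivAt.pow 2).unique h1
    have := DFunLike.congr_fun h2 v
    simp at this
    exact this
  rw [e.fderiv_eq, fderiv_fun_smul hn hg]
  simp [hd]

end basic

/-- Smooth tangent vector fields on `Sⁿ`, as smooth maps `X : Sⁿ → ℝⁿ⁺¹` with `X p ⟂ p`. -/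
def tangentFields (n : ℕ) : Submodule ℝ C^∞⟮𝓡 n, Sph n; 𝓘(ℝ, Amb n), Amb n⟯ where
  carrier := {X | ∀ p, ⟪X p, (p : Amb n)⟫_ℝ = 0}
  zero_mem' p := by simp
  add_mem' {X Y} hX hY p := by
    simp only [ContMDiffMap.coe_add, Pi.add_apply, inner_add_left]
    rw [hX p, hY p, add_zero]
  smul_mem' c X hX p := by
    simp only [ContMDiffMap.coe_smul, Pi.smul_apply, inner_smul_left]
    rw [hX p, mul_zero]

/-- The space `𝔛(Sⁿ)` of smooth vector fields on the sphere. -/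
abbrev VF (n : ℕ) := ↥(tangentFields n)

namespace VF

variable {n : ℕ}

/-- The radial extension of a vector field. -/
abbrev ext0 (X : VF n) : Amb n → Amb n := radialExt X.1

theorem smooth (X : VF n) {y : Amb n} (hy : y ≠ 0) : ContDiffAt ℝ ∞ X.ext0 y :=
  contDiffAt_radialExt X.1.contMDiff hy

theorem diff (X : VF n) {y : Amb n} (hy : y ≠ 0) : DifferentiableAt ℝ X.ext0 y :=
  (X.smooth hy).differentiableAt (by simp)

theorem inner_ext (X : VF n) (y : Amb n) : ⟪X.ext0 y, y⟫_ℝ = 0 := by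
  by_cases hy : y = 0
  · simp [hy]
  · obtain ⟨p, hp, h⟩ := exists_radial (Amb n) hy
    have := X.2 p
    rw [hp, inner_smul_right] at this
    rw [ext0, h]
    simpa [hy] using this

theorem inner_fderiv (X : VF n) (p : Sph n) (v : Amb n) :
    ⟪fderiv ℝ X.ext0 p v, (p : Amb n)⟫_ℝ = - ⟪X.ext0 p, v⟫_ℝ := by
  have h : fderiv ℝ (fun y => ⟪X.ext0 y, y⟫_ℝ) p v = 0 := by
    have : (fun y => ⟪X.ext0 y, y⟫_ℝ) = fun _ => 0 := by ext y; exact X.inner_ext y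
    rw [this]; simp
  rw [fderiv_inner_apply ℝ (X.diff (coe_ne_zero p)) differentiableAt_fun_id] at h
  simp at h
  linarith

theorem smooth_lieBracket (X Y : VF n) {y : Amb n} (hy : y ≠ 0) :
    ContDiffAt ℝ ∞ (VectorField.lieBracket ℝ X.ext0 Y.ext0) y :=
  (X.smooth hy).lieBracket_vectorField (Y.smooth hy) (m := ∞) (by simp)

/-- The Lie bracket `[X, Y] = D_X Y - D_Y X` of vector fields on the sphere. -/
def bracket (X Y : VF n) : VF n :=
  ⟨⟨fun p => VectorField.lieBracket ℝ X.ext0 Y.ext0 p,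
    contMDiff_restrict fun _ hy => smooth_lieBracket X Y hy⟩, fun p => by
      change ⟪VectorField.lieBracket ℝ X.ext0 Y.ext0 p, (p : Amb n)⟫_ℝ = 0
      rw [VectorField.lieBracket, inner_sub_left, inner_fderiv, inner_fderiv, real_inner_comm]
      ring⟩

theorem bracket_apply (X Y : VF n) (p : Sph n) :
    (bracket X Y).1 p = VectorField.lieBracket ℝ X.ext0 Y.ext0 p := rfl

theorem ext0_bracket (X Y : VF n) {y : Amb n} (hy : y ≠ 0) :
    (bracket X Y).ext0 y = ‖y‖ • VectorField.lieBracket ℝ X.ext0 Y.ext0 y := by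
  obtain ⟨p, hp, h⟩ := exists_radial (Amb n) hy
  have hc : 0 < ‖y‖⁻¹ := by positivity
  rw [ext0, h, bracket_apply, hp, VectorField.lieBracket, VectorField.lieBracket]
  simp only [ext0]
  rw [radialExt_smul _ hc, radialExt_smul _ hc, fderiv_radialExt_smul _ hc,
    fderiv_radialExt_smul _ hc]
  simp [smul_sub]

theorem ext0_add (X Y : VF n) : (X + Y).ext0 = X.ext0 + Y.ext0 := by
  ext1 y; by_cases hy : y = 0 <;> simp [radialExt, hy]

theorem ext0_smul (c : ℝ) (X : VF n) : (c • X).ext0 = c • X.ext0 := by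
  ext1 y; by_cases hy : y = 0 <;> simp [radialExt, hy]

theorem fderiv_ext0_bracket (X Y : VF n) (p : Sph n) (v : Amb n) :
    fderiv ℝ (bracket X Y).ext0 p v
      = fderiv ℝ (VectorField.lieBracket ℝ X.ext0 Y.ext0) p v
        + ⟪(p : Amb n), v⟫_ℝ • (bracket X Y).1 p :=
  fderiv_eq_of_norm_smul p ((smooth_lieBracket X Y (coe_ne_zero p)).differentiableAt (by simp))
    (fun _ hy => ext0_bracket X Y hy) v

theorem bracket_bracket (X Y Z : VF n) (p : Sph n) :
    (bracket X (bracket Y Z)).1 p = VectorField.lieBracket ℝ X.ext0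
      (VectorField.lieBracket ℝ Y.ext0 Z.ext0) p := by
  rw [bracket_apply, VectorField.lieBracket, VectorField.lieBracket]
  have e : (bracket Y Z).ext0 p = VectorField.lieBracket ℝ Y.ext0 Z.ext0 p := by
    rw [ext0, radialExt_coe, bracket_apply]
  rw [e, fderiv_ext0_bracket, real_inner_comm, X.inner_ext p]
  simp

theorem vf_ext {X Y : VF n} (h : ∀ p, X.1 p = Y.1 p) : X = Y :=
  Subtype.ext (ContMDiffMap.ext h)

instance : LieRing (VF n) where
  bracket := bracket
  add_lie X Y Z := vf_ext fun p => by
    change VectorField.lieBracket ℝ (X + Y).ext0 Z.ext0 p =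
      VectorField.lieBracket ℝ X.ext0 Z.ext0 p + VectorField.lieBracket ℝ Y.ext0 Z.ext0 p
    rw [ext0_add, VectorField.lieBracket_add_left (X.diff (coe_ne_zero p)) (Y.diff (coe_ne_zero p))]
  lie_add X Y Z := vf_ext fun p => by
    change VectorField.lieBracket ℝ X.ext0 (Y + Z).ext0 p =
      VectorField.lieBracket ℝ X.ext0 Y.ext0 p + VectorField.lieBracket ℝ X.ext0 Z.ext0 p
    rw [ext0_add, VectorField.lieBracket_add_right (Y.diff (coe_ne_zero p)) (Z.diff (coe_ne_zero p))]
  lie_self X := vf_ext fun p => by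
    change VectorField.lieBracket ℝ X.ext0 X.ext0 p = 0
    simp
  leibniz_lie X Y Z := vf_ext fun p => by
    change (bracket X (bracket Y Z)).1 p =
      (bracket (bracket X Y) Z).1 p + (bracket Y (bracket X Z)).1 p
    have e : (bracket (bracket X Y) Z).1 p = - (bracket Z (bracket X Y)).1 p := by
      rw [bracket_apply, bracket_apply, VectorField.lieBracket_swap]
    rw [e, bracket_bracket, bracket_bracket, bracket_bracket]
    have h0 := coe_ne_zero p
    have key := VectorField.leibniz_identity_lieBracket (𝕜 := ℝ) (n := 2) (by simp)
      ((X.smooth h0).of_le two_le_smooth)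
      ((Y.smooth h0).of_le two_le_smooth)
      ((Z.smooth h0).of_le two_le_smooth)
    rw [key, VectorField.lieBracket_swap (V := Z.ext0), neg_neg]

instance : LieAlgebra ℝ (VF n) where
  lie_smul c X Y := vf_ext fun p => by
    change VectorField.lieBracket ℝ X.ext0 (c • Y).ext0 p =
      c • VectorField.lieBracket ℝ X.ext0 Y.ext0 p
    rw [ext0_smul, VectorField.lieBracket_const_smul_right (Y.diff (coe_ne_zero p))]

theorem lie_apply (X Y : VF n) (p : Sph n) :
    (⁅X, Y⁆ : VF n).1 p = VectorField.lieBracket ℝ X.ext0 Y.ext0 p := rfl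

theorem smooth_fun (f : SmoothFun n) {y : Amb n} (hy : y ≠ 0) :
    ContDiffAt ℝ ∞ (radialExt f) y :=
  contDiffAt_radialExt f.contMDiff hy

theorem smooth_deriv (X : VF n) (f : SmoothFun n) {y : Amb n} (hy : y ≠ 0) :
    ContDiffAt ℝ ∞ (fun y => fderiv ℝ (radialExt f) y (X.ext0 y)) y :=
  ((smooth_fun f hy).fderiv_right (m := ∞) (by simp)).clm_apply (X.smooth hy)

/-- The derivative `X f` of a function along a vector field, `(X f)(p) = df_p (X p)`. -/
def deriv (X : VF n) (f : SmoothFun n) : SmoothFun n :=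
  ⟨fun p => fderiv ℝ (radialExt f) p (X.ext0 p), contMDiff_restrict fun _ hy => smooth_deriv X f hy⟩

theorem deriv_apply (X : VF n) (f : SmoothFun n) (p : Sph n) :
    X.deriv f p = fderiv ℝ (radialExt f) p (X.ext0 p) := rfl

theorem radialExt_deriv (X : VF n) (f : SmoothFun n) {y : Amb n} (hy : y ≠ 0) :
    radialExt (X.deriv f) y = ‖y‖ • fderiv ℝ (radialExt f) y (X.ext0 y) := by
  obtain ⟨p, hp, h⟩ := exists_radial ℝ hy
  have hc : 0 < ‖y‖⁻¹ := by positivity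
  rw [h, deriv_apply, hp]
  simp only [ext0]
  rw [radialExt_smul _ hc, fderiv_radialExt_smul _ hc]
  simp

theorem deriv_deriv (X Y : VF n) (f : SmoothFun n) (p : Sph n) :
    X.deriv (Y.deriv f) p =
      fderiv ℝ (fun y => fderiv ℝ (radialExt f) y (Y.ext0 y)) p (X.ext0 p) := by
  rw [deriv_apply, fderiv_eq_of_norm_smul p
    ((smooth_deriv Y f (coe_ne_zero p)).differentiableAt (by simp))
    (fun y hy => radialExt_deriv Y f hy), real_inner_comm, X.inner_ext p]
  simp

/-- `C^∞(Sⁿ)` as a module over the Lie algebra of vector fields, `⁅X, f⁆ = X f`. -/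
instance : LieRingModule (VF n) (SmoothFun n) where
  bracket := deriv
  add_lie X Y f := ContMDiffMap.ext fun p => by
    change fderiv ℝ (radialExt f) p ((X + Y).ext0 p) =
      fderiv ℝ (radialExt f) p (X.ext0 p) + fderiv ℝ (radialExt f) p (Y.ext0 p)
    rw [ext0_add]; simp
  lie_add X f g := ContMDiffMap.ext fun p => by
    change fderiv ℝ (radialExt (f + g)) p (X.ext0 p) =
      fderiv ℝ (radialExt f) p (X.ext0 p) + fderiv ℝ (radialExt g) p (X.ext0 p)
    have e : radialExt (f + g) = radialExt f + radialExt g := by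
      ext1 y; by_cases hy : y = 0 <;> simp [radialExt, hy]
    rw [e, fderiv_add ((smooth_fun f (coe_ne_zero p)).differentiableAt (by simp))
      ((smooth_fun g (coe_ne_zero p)).differentiableAt (by simp))]
    simp
  leibniz_lie X Y f := ContMDiffMap.ext fun p => by
    change X.deriv (Y.deriv f) p = (bracket X Y).deriv f p + Y.deriv (X.deriv f) p
    have h0 := coe_ne_zero p
    have e : (bracket X Y).ext0 p = VectorField.lieBracket ℝ X.ext0 Y.ext0 p := by
      rw [ext0, radialExt_coe, bracket_apply]
    rw [deriv_deriv, deriv_deriv, deriv_apply, e,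
      VectorField.fderiv_apply_lieBracket (n := 2)
        ((smooth_fun f h0).of_le two_le_smooth) (by simp) (Y.diff h0) (X.diff h0)]
    ring

instance : LieModule ℝ (VF n) (SmoothFun n) where
  smul_lie c X f := ContMDiffMap.ext fun p => by
    change fderiv ℝ (radialExt f) p ((c • X).ext0 p) = c • fderiv ℝ (radialExt f) p (X.ext0 p)
    rw [ext0_smul]; simp
  lie_smul c X f := ContMDiffMap.ext fun p => by
    change fderiv ℝ (radialExt (c • f)) p (X.ext0 p) = c • fderiv ℝ (radialExt f) p (X.ext0 p)
    have e : radialExt (c • f) = c • radialExt f := by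
      ext1 y; by_cases hy : y = 0 <;> simp [radialExt, hy]
    rw [e, fderiv_const_smul ((smooth_fun f (coe_ne_zero p)).differentiableAt (by simp))]
    simp

theorem lie_fun_apply (X : VF n) (f : SmoothFun n) (p : Sph n) :
    ⁅X, f⁆ p = fderiv ℝ (radialExt f) p (X.ext0 p) := rfl

/-- The divergence of a vector field on the round sphere: `(div X)(p) = ∑ ⟪D_{eᵢ} X, eᵢ⟫` over an
orthonormal basis `(eᵢ)` of the tangent space `p^⊥`. The radial direction does not
contribute, since the extension of `X` is constant along rays. -/
def div (X : VF n) (p : Sph n) : ℝ :=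
  LinearMap.trace ℝ (Amb n) (fderiv ℝ X.ext0 p : Amb n →ₗ[ℝ] Amb n)

/-- The trace as a continuous linear functional on the endomorphisms of `ℝⁿ⁺¹`. -/
def traceL (n : ℕ) : (Amb n →L[ℝ] Amb n) →L[ℝ] ℝ :=
  LinearMap.toContinuousLinearMap
    ((LinearMap.trace ℝ (Amb n)).comp (ContinuousLinearMap.coeLM ℝ))

theorem traceL_apply (A : Amb n →L[ℝ] Amb n) :
    traceL n A = LinearMap.trace ℝ (Amb n) (A : Amb n →ₗ[ℝ] Amb n) := rfl

theorem div_eq_traceL (X : VF n) (p : Sph n) : X.div p = traceL n (fderiv ℝ X.ext0 p) := rfl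

theorem trace_fderiv_eq_zero {X : VF n} (hX : ∀ p, X.div p = 0) {y : Amb n} (hy : y ≠ 0) :
    traceL n (fderiv ℝ X.ext0 y) = 0 := by
  obtain ⟨p, hp, -⟩ := exists_radial (Amb n) hy
  have h := hX p
  rw [div_eq_traceL, hp, fderiv_radialExt_smul _ (by positivity), map_smul] at h
  simpa [hy] using h

theorem trace_snd_eq_zero {X : VF n} (hX : ∀ p, X.div p = 0) (p : Sph n) (w : Amb n) :
    traceL n (fderiv ℝ (fderiv ℝ X.ext0) p w) = 0 := by
  have h0 := coe_ne_zero p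
  have hd : DifferentiableAt ℝ (fderiv ℝ X.ext0) p :=
    ((X.smooth h0).fderiv_right (m := 1) (by simpa [one_add_one_eq_two] using two_le_smooth)).differentiableAt (by simp)
  have h1 := ((traceL n).hasFDerivAt.comp (p : Amb n) hd.hasFDerivAt).fderiv
  have h2 : (traceL n ∘ fderiv ℝ X.ext0) =ᶠ[nhds (p : Amb n)] fun _ => 0 := by
    filter_upwards [isOpen_ne.mem_nhds h0] with y hy using trace_fderiv_eq_zero hX hy
  rw [h2.fderiv_eq] at h1
  have := DFunLike.congr_fun h1 w
  simpa using this.symm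

theorem fderiv_lieBracket_apply (X Y : VF n) (p : Sph n) (v : Amb n) :
    fderiv ℝ (VectorField.lieBracket ℝ X.ext0 Y.ext0) p v =
      (fderiv ℝ (fderiv ℝ Y.ext0) p (X.ext0 p) v + fderiv ℝ Y.ext0 p (fderiv ℝ X.ext0 p v)) -
      (fderiv ℝ (fderiv ℝ X.ext0) p (Y.ext0 p) v + fderiv ℝ X.ext0 p (fderiv ℝ Y.ext0 p v)) := by
  have h0 := coe_ne_zero p
  have hX : DifferentiableAt ℝ (fderiv ℝ X.ext0) p :=
    ((X.smooth h0).fderiv_right (m := 1) (by simpa [one_add_one_eq_two] using two_le_smooth)).differentiableAt (by simp)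
  have hY : DifferentiableAt ℝ (fderiv ℝ Y.ext0) p :=
    ((Y.smooth h0).fderiv_right (m := 1) (by simpa [one_add_one_eq_two] using two_le_smooth)).differentiableAt (by simp)
  have sX : IsSymmSndFDerivAt ℝ X.ext0 p := (X.smooth h0).isSymmSndFDerivAt (by simpa using two_le_smooth)
  have sY : IsSymmSndFDerivAt ℝ Y.ext0 p := (Y.smooth h0).isSymmSndFDerivAt (by simpa using two_le_smooth)
  have e : VectorField.lieBracket ℝ X.ext0 Y.ext0 =
      fun y => fderiv ℝ Y.ext0 y (X.ext0 y) - fderiv ℝ X.ext0 y (Y.ext0 y) := rfl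
  rw [e, fderiv_fun_sub (hY.clm_apply (X.diff h0)) (hX.clm_apply (Y.diff h0)),
    fderiv_clm_apply hY (X.diff h0), fderiv_clm_apply hX (Y.diff h0)]
  simp [sY.eq v, sX.eq v]
  abel

theorem div_lie {X Y : VF n} (hX : ∀ p, X.div p = 0) (hY : ∀ p, Y.div p = 0) (p : Sph n) :
    (⁅X, Y⁆ : VF n).div p = 0 := by
  set A := fderiv ℝ X.ext0 p
  set B := fderiv ℝ Y.ext0 p
  have e : fderiv ℝ (bracket X Y).ext0 p =
      (fderiv ℝ (fderiv ℝ Y.ext0) p (X.ext0 p) + B.comp A) -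
      (fderiv ℝ (fderiv ℝ X.ext0) p (Y.ext0 p) + A.comp B) +
      (innerSL ℝ (p : Amb n)).smulRight ((bracket X Y).1 p) := by
    ext1 v
    rw [fderiv_ext0_bracket, fderiv_lieBracket_apply]
    simp [A, B]
  change (bracket X Y).div p = 0
  have hc : traceL n (B.comp A) = traceL n (A.comp B) := by
    rw [traceL_apply, traceL_apply]
    exact LinearMap.trace_mul_comm ℝ (B : Amb n →ₗ[ℝ] Amb n) (A : Amb n →ₗ[ℝ] Amb n)
  have hr : traceL n ((innerSL ℝ (p : Amb n)).smulRight ((bracket X Y).1 p)) = 0 := by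
    rw [traceL_apply]
    have := LinearMap.trace_smulRight ((innerSL ℝ (p : Amb n)) : Amb n →ₗ[ℝ] ℝ)
      ((bracket X Y).1 p)
    refine this.trans ?_
    simp only [ContinuousLinearMap.coe_coe, innerSL_apply_apply]
    rw [real_inner_comm]
    exact (bracket X Y).2 p
  rw [div_eq_traceL, e, map_add, map_sub, map_add, map_add, trace_snd_eq_zero hX,
    trace_snd_eq_zero hY, hc, hr]
  ring

theorem div_add (X Y : VF n) (p : Sph n) : (X + Y).div p = X.div p + Y.div p := by
  have h0 := coe_ne_zero p
  rw [div_eq_traceL, ext0_add, fderiv_add (X.diff h0) (Y.diff h0), map_add]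
  rfl

theorem div_smul (c : ℝ) (X : VF n) (p : Sph n) : (c • X).div p = c * X.div p := by
  have h0 := coe_ne_zero p
  rw [div_eq_traceL, ext0_smul, fderiv_const_smul (X.diff h0), map_smul]
  rfl

end VF

/-- The Lie algebra `𝔛_μ(Sⁿ)` of divergence-free vector fields on `Sⁿ`. -/
def divFree (n : ℕ) : LieSubalgebra ℝ (VF n) where
  carrier := {X | ∀ p, X.div p = 0}
  zero_mem' p := by
    have := VF.div_smul (0 : ℝ) (0 : VF n) p
    simpa using this
  add_mem' hX hY p := by rw [VF.div_add, hX p, hY p, add_zero]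
  smul_mem' c X hX p := by rw [VF.div_smul, hX p, mul_zero]
  lie_mem' hX hY := VF.div_lie hX hY

/-- The vector field `p ↦ A p` on `S³` given by a linear map `A` with `A y ⟂ y`. -/
def linearField (A : Amb 3 →ₗ[ℝ] Amb 3) (hA : ∀ y, ⟪A y, y⟫_ℝ = 0) : VF 3 :=
  ⟨⟨fun p => A p, contMDiff_restrict fun _ _ => A.toContinuousLinearMap.contDiff.contDiffAt⟩,
    fun p => hA p⟩

/-- The matrix of `E₁ = ½ (w ∂_x - z ∂_y + y ∂_z - x ∂_w)` in the coordinates `(x, y, z, w)`. -/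
def matE1 : Matrix (Fin 4) (Fin 4) ℝ :=
  (1 / 2 : ℝ) • !![0, 0, 0, 1; 0, 0, -1, 0; 0, 1, 0, 0; -1, 0, 0, 0]

/-- The matrix of `E₂ = ½ (z ∂_x + w ∂_y - x ∂_z - y ∂_w)` in the coordinates `(x, y, z, w)`. -/
def matE2 : Matrix (Fin 4) (Fin 4) ℝ :=
  (1 / 2 : ℝ) • !![0, 0, 1, 0; 0, 0, 0, 1; -1, 0, 0, 0; 0, -1, 0, 0]

/-- The matrix of `E₃ = ½ (-y ∂_x + x ∂_y + w ∂_z - z ∂_w)` in the coordinates `(x, y, z, w)`. -/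
def matE3 : Matrix (Fin 4) (Fin 4) ℝ :=
  (1 / 2 : ℝ) • !![0, -1, 0, 0; 1, 0, 0, 0; 0, 0, 0, 1; 0, 0, -1, 0]

/-- The Hopf field `E₁` on `S³`. -/
def E1 : VF 3 := linearField (Matrix.toEuclideanLin matE1) fun y => by
  simp [matE1, PiLp.inner_apply, Fin.sum_univ_four, Matrix.toLpLin_apply, dotProduct]
  ring

/-- The field `E₂` on `S³`. -/
def E2 : VF 3 := linearField (Matrix.toEuclideanLin matE2) fun y => by
  simp [matE2, PiLp.inner_apply, Fin.sum_univ_four, Matrix.toLpLin_apply, dotProduct]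
  ring

/-- The field `E₃` on `S³`. -/
def E3 : VF 3 := linearField (Matrix.toEuclideanLin matE3) fun y => by
  simp [matE3, PiLp.inner_apply, Fin.sum_univ_four, Matrix.toLpLin_apply, dotProduct]
  ring

/-- The Lie algebra `𝔛¹_μ(S³)` of divergence-free vector fields `u` on `S³` that are
`E₁`-invariant, `[E₁, u] = 0`. -/
def hopfDivFree : LieSubalgebra ℝ (VF 3) where
  carrier := {u | u ∈ divFree 3 ∧ ⁅E1, u⁆ = 0}
  zero_mem' := ⟨(divFree 3).zero_mem, lie_zero _⟩
  add_mem' hX hY := ⟨(divFree 3).add_mem hX.1 hY.1, by rw [lie_add, hX.2, hY.2, add_zero]⟩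
  smul_mem' c X hX := ⟨(divFree 3).smul_mem c hX.1, by rw [lie_smul, hX.2, smul_zero]⟩
  lie_mem' hX hY := ⟨(divFree 3).lie_mem hX.1 hY.1, by
    rw [leibniz_lie, hX.2, hY.2, zero_lie, lie_zero, add_zero]⟩

/-- The Hopf map `ℝ⁴ → ℝ³`; for `q = w + xi + yj + zk` it is `q ↦ q̄ i q`. -/
def hopfAmb (q : Amb 3) : Amb 2 :=
  !₂[q 3 ^ 2 + q 0 ^ 2 - q 1 ^ 2 - q 2 ^ 2,
     2 * (q 0 * q 1 - q 3 * q 2),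
     2 * (q 0 * q 2 + q 3 * q 1)]

theorem hopfAmb_mem (p : Sph 3) : hopfAmb p ∈ Sph 2 := by
  have hp : ‖(p : Amb 3)‖ = 1 := by simp
  have h2 : ‖(p : Amb 3)‖ ^ 2 = 1 := by rw [hp]; norm_num
  rw [EuclideanSpace.norm_sq_eq, Fin.sum_univ_four] at h2
  simp only [Real.norm_eq_abs, sq_abs] at h2
  rw [mem_sphere_zero_iff_norm, ← sq_eq_sq₀ (norm_nonneg _) zero_le_one,
    EuclideanSpace.norm_sq_eq, Fin.sum_univ_three]
  simp only [Real.norm_eq_abs, sq_abs, hopfAmb]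
  simp
  linear_combination (((p : Amb 3) 0) ^ 2 + ((p : Amb 3) 1) ^ 2 + ((p : Amb 3) 2) ^ 2
    + ((p : Amb 3) 3) ^ 2 + 1) * h2

/-- The Hopf map `π : S³ → S²`, whose fibres are the orbits of the flow of `E₁`. -/
def hopf : C^∞⟮𝓡 3, Sph 3; 𝓡 2, Sph 2⟯ :=
  ⟨Set.codRestrict (fun p : Sph 3 => hopfAmb p) (Sph 2) hopfAmb_mem, by
    have := Fact.mk (@finrank_euclideanSpace_fin ℝ _ (2 + 1))
    refine ContMDiff.codRestrict_sphere (n := 2) (contMDiff_restrict fun y _ => ?_) _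
    refine ContDiff.contDiffAt ?_
    rw [contDiff_euclidean]
    intro i
    fin_cases i <;> simp [hopfAmb] <;> fun_prop⟩

/-- The pullback `π^* f = f ∘ π` of a function along the Hopf map. -/
def hopfPullback (f : SmoothFun 2) : SmoothFun 3 := f.comp hopf

/-- The cross product on Euclidean three-space. -/
def cross (a b : Amb 2) : Amb 2 := WithLp.toLp 2 (crossProduct a.ofLp b.ofLp)

/-- The gradient on `S²` of a function. -/
def sgrad (f : SmoothFun 2) (p : Sph 2) : Amb 2 := ∇ (radialExt f) p

theorem smooth_gradient (f : SmoothFun 2) {y : Amb 2} (hy : y ≠ 0) :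
    ContDiffAt ℝ ∞ (∇ (radialExt f)) y :=
  (InnerProductSpace.toDual ℝ (Amb 2)).symm.contDiff.contDiffAt.comp y
    ((VF.smooth_fun f hy).fderiv_right (m := ∞) (by simp))

theorem contDiff_coord (i : Fin 3) : ContDiff ℝ ∞ (fun a : Amb 2 => a i) := by fun_prop

theorem smooth_cross {f g : Amb 2 → Amb 2} {y : Amb 2} (hf : ContDiffAt ℝ ∞ f y)
    (hg : ContDiffAt ℝ ∞ g y) : ContDiffAt ℝ ∞ (fun y => cross (f y) (g y)) y := by
  have hf' : ∀ i, ContDiffAt ℝ ∞ (fun y => f y i) y := fun i =>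
    (contDiff_coord i).contDiffAt.comp y hf
  have hg' : ∀ i, ContDiffAt ℝ ∞ (fun y => g y i) y := fun i =>
    (contDiff_coord i).contDiffAt.comp y hg
  rw [contDiffAt_euclidean]
  intro i
  fin_cases i <;> simp [cross, cross_apply]
  · exact ((hf' 1).mul (hg' 2)).sub ((hf' 2).mul (hg' 1))
  · exact ((hf' 2).mul (hg' 0)).sub ((hf' 0).mul (hg' 2))
  · exact ((hf' 0).mul (hg' 1)).sub ((hf' 1).mul (hg' 0))

/-- The Poisson bracket on `S²`, `{f, h} μ = df ∧ dh` with `μ` the area form of the unit sphere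
oriented by the outward normal: `{f, h}(p) = p · (∇f × ∇h)`. -/
def poisson (f h : SmoothFun 2) : SmoothFun 2 :=
  ⟨fun p => ⟪(p : Amb 2), cross (sgrad f p) (sgrad h p)⟫_ℝ, contMDiff_restrict
    (g := fun y => ⟪y, cross (∇ (radialExt f) y) (∇ (radialExt h) y)⟫_ℝ) fun _ hy =>
      contDiffAt_id.inner ℝ (smooth_cross (smooth_gradient f hy) (smooth_gradient h hy))⟩

/-- The Hamiltonian vector field `X_ψ` on `S²` with stream function `ψ`: `X_ψ(p) = p × ∇ψ(p)`. -/
def hamField (ψ : SmoothFun 2) : VF 2 :=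
  ⟨⟨fun p => cross p (sgrad ψ p), contMDiff_restrict (g := fun y => cross y (∇ (radialExt ψ) y))
    fun _ hy => smooth_cross contDiffAt_id (smooth_gradient ψ hy)⟩, fun p => by
      change ⟪cross p (sgrad ψ p), (p : Amb 2)⟫_ℝ = 0
      simp [cross, cross_apply, PiLp.inner_apply, Fin.sum_univ_three]
      ring⟩

/-- The vector field `u` on `S³` has the form `u = σ E₁ - (E₃ ψ) E₂ + (E₂ ψ) E₃`. -/
def HasForm (u : VF 3) (σ ψ : SmoothFun 3) : Prop :=
  ∀ p, u.1 p = σ p • E1.1 p - ⁅E3, ψ⁆ p • E2.1 p + ⁅E2, ψ⁆ p • E3.1 p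

end SphereFlow

end

open SphereFlow

/-!
On `S²`, rotating a field by a right angle turns divergence into curl, so the divergence-free fields
are the rotated curl-free ones; and a curl-free field on `Sⁿ`, `n ≥ 2`, is a gradient, because
extended homogeneously to `ℝⁿ⁺¹ ∖ {0}` it is a closed form, with primitives on the complements of
two opposite rays, whose intersection is connected. This gives the stream functions.

On `S³`, for `u = c₁ E₁ + c₂ E₂ + c₃ E₃` the conditions `[E₁, u] = 0` and `div u = 0` say that
`E₁ c₁ = 0` and that the form with values `0, c₃, -c₂` on `E₁, E₂, E₃` is closed, hence equal to
`dψ`. A function killed by `E₁` is constant on the Hopf circles and descends to `S²` along local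
sections of the Hopf map.

As `dπ` maps `E₂`, `E₃` to an oriented orthonormal frame of `S²`,
`π^*{f, h} = E₂(π^*f) E₃(π^*h) - E₃(π^*f) E₂(π^*h)`, which reduces the Jacobi identity and the
bracket of the extension to the structure equations `[E₁, E₂] = -E₃`, `[E₂, E₃] = -E₁`,
`[E₁, E₃] = E₂` of the frame.
-/

noncomputable section

namespace SphereFlow

section Poincare

open Set

variable {E F : Type*} [NormedAddCommGroup E] [NormedSpace ℝ E] [NormedAddCommGroup F]
  [NormedSpace ℝ F]

theorem exists_primitive_of_starConvex [CompleteSpace F] {U : Set E} {a : E} (hU : IsOpen U)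
    (hs : StarConvex ℝ a U) {α : E → E →L[ℝ] F} (hα : DifferentiableOn ℝ α U)
    (hsymm : ∀ x ∈ U, ∀ v w, fderiv ℝ α x v w = fderiv ℝ α x w v) :
    ∃ f : E → F, ∀ x ∈ U, HasFDerivAt f (α x) x := by
  refine ⟨fun b => ∫ᶜ x in .segment a b, α x, fun b hb => ?_⟩
  -- A thickening of the segment is convex, which is what the primitive along segments requires.
  have hc : IsCompact (segment ℝ a b) := by
    rw [segment_eq_image_lineMap]
    exact isCompact_Icc.image AffineMap.lineMap_continuous
  obtain ⟨δ, hδ, hV⟩ := hc.exists_thickening_subset_open hU (hs.segment_subset hb)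
  have hsub : segment ℝ a b ⊆ Metric.thickening δ (segment ℝ a b) :=
    Metric.self_subset_thickening hδ _
  refine (Convex.hasFDerivWithinAt_curveIntegral_segment_of_hasFDerivWithinAt_symmetric
    (dω := fderiv ℝ α) ((convex_segment a b).thickening δ)
    (fun x hx => (hα.differentiableAt (hU.mem_nhds (hV hx))).hasFDerivAt.hasFDerivWithinAt)
    (fun x hx v _ w _ => hsymm x (hV hx) v w)
    (hsub (left_mem_segment ℝ a b)) (hsub (right_mem_segment ℝ a b))).hasFDerivAt ?_
  exact Metric.isOpen_thickening.mem_nhds (hsub (right_mem_segment ℝ a b))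

/-- The complement of the closed ray opposite to `N`, an open set that is star-convex about `N`. -/
def slit (N : E) : Set E := ((fun t : ℝ => t • N) '' Iic 0)ᶜ

theorem isOpen_slit (N : E) : IsOpen (slit N) :=
  (isClosedMap_smul_left N _ isClosed_Iic).isOpen_compl

theorem ne_zero_of_mem_slit {N y : E} (hy : y ∈ slit N) : y ≠ 0 := by
  rintro rfl
  exact hy ⟨0, self_mem_Iic, zero_smul ℝ N⟩

theorem starConvex_slit {N : E} (hN : N ≠ 0) : StarConvex ℝ N (slit N) := by
  rintro b hb s t hs ht hst ⟨r, hr, h : r • N = s • N + t • b⟩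
  have hr : r ≤ 0 := hr
  have htb : t • b = (r - s) • N := by rw [sub_smul, h, add_sub_cancel_left]
  rcases ht.eq_or_lt with rfl | ht
  · rw [zero_smul, eq_comm, smul_eq_zero, or_iff_left hN] at htb
    linarith
  · have hray : t⁻¹ * (r - s) ≤ 0 :=
      mul_nonpos_of_nonneg_of_nonpos (by positivity) (by linarith)
    refine hb ⟨t⁻¹ * (r - s), hray, ?_⟩
    change (t⁻¹ * (r - s)) • N = b
    rw [mul_smul, ← htb, inv_smul_smul₀ ht.ne']

theorem mem_slit_or_mem_slit_neg {N y : E} (hN : N ≠ 0) (hy : y ≠ 0) :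
    y ∈ slit N ∨ y ∈ slit (-N) := by
  by_contra! h
  simp only [slit, notMem_compl_iff] at h
  obtain ⟨⟨s, hs, rfl⟩, t, ht, hst : t • -N = s • N⟩ := h
  have hst : -t = s := smul_left_injective ℝ hN (by simpa using hst)
  have hs0 : s = 0 := le_antisymm hs (by have : t ≤ 0 := ht; linarith)
  exact hy (by simp [hs0])

theorem slit_inter_slit_neg (N : E) : slit N ∩ slit (-N) = ((ℝ ∙ N : Submodule ℝ E) : Set E)ᶜ := by
  rw [slit, slit, ← compl_union, compl_inj_iff]
  ext y
  simp only [mem_union, mem_image, mem_Iic, SetLike.mem_coe, Submodule.mem_span_singleton]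
  constructor
  · rintro (⟨t, -, rfl⟩ | ⟨t, -, rfl⟩)
    · exact ⟨t, rfl⟩
    · exact ⟨-t, by simp⟩
  · rintro ⟨t, rfl⟩
    rcases le_total t 0 with ht | ht
    · exact .inl ⟨t, ht, rfl⟩
    · exact .inr ⟨-t, by linarith, by simp⟩

theorem isPreconnected_slit_inter_slit_neg (hE : 2 < Module.rank ℝ E) (N : E) :
    IsPreconnected (slit N ∩ slit (-N)) := by
  rw [slit_inter_slit_neg]
  refine (isConnected_compl_of_one_lt_codim ?_).isPreconnected
  by_contra! h
  refine hE.not_ge ?_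
  rw [← Submodule.rank_quotient_add_rank (ℝ ∙ N), ← one_add_one_eq_two]
  exact add_le_add h ((rank_span_le _).trans (by simp))

theorem exists_primitive_compl_zero [CompleteSpace F] (hE : 2 < Module.rank ℝ E)
    {α : E → E →L[ℝ] F} (hα : ∀ y, y ≠ 0 → DifferentiableAt ℝ α y)
    (hsymm : ∀ y, y ≠ 0 → ∀ v w, fderiv ℝ α y v w = fderiv ℝ α y w v) :
    ∃ f : E → F, ∀ y, y ≠ 0 → HasFDerivAt f (α y) y := by
  obtain ⟨N, hN⟩ := rank_pos_iff_exists_ne_zero.1 (two_pos.trans hE)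
  have hex (M : E) (hM : M ≠ 0) : ∃ f : E → F, ∀ y ∈ slit M, HasFDerivAt f (α y) y :=
    exists_primitive_of_starConvex (isOpen_slit M) (starConvex_slit hM)
      (fun y hy => (hα y (ne_zero_of_mem_slit hy)).differentiableWithinAt)
      fun y hy => hsymm y (ne_zero_of_mem_slit hy)
  obtain ⟨f, hf⟩ := hex N hN
  obtain ⟨g, hg⟩ := hex (-N) (neg_ne_zero.2 hN)
  have hsub (y : E) (hy : y ∈ slit N ∩ slit (-N)) :
      HasFDerivAt (fun y => f y - g y) (0 : E →L[ℝ] F) y := by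
    simpa only [sub_self] using (hf y hy.1).fun_sub (hg y hy.2)
  obtain ⟨c, hc⟩ := ((isOpen_slit N).inter (isOpen_slit (-N))).exists_is_const_of_fderiv_eq_zero
    (isPreconnected_slit_inter_slit_neg hE N)
    (fun y hy => (hsub y hy).differentiableAt.differentiableWithinAt) fun y hy => (hsub y hy).fderiv
  classical
  refine ⟨fun y => if y ∈ slit N then f y else g y + c, fun y hy => ?_⟩
  rcases mem_slit_or_mem_slit_neg hN hy with h | h
  · refine (hf y h).congr_of_eventuallyEq ?_
    filter_upwards [(isOpen_slit N).mem_nhds h] with z hz using if_pos hz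
  · refine ((hg y h).add_const c).congr_of_eventuallyEq ?_
    filter_upwards [(isOpen_slit (-N)).mem_nhds h] with z hz
    split_ifs with hzN
    · exact sub_eq_iff_eq_add'.1 (hc z ⟨hzN, hz⟩)
    · rfl

theorem contDiffAt_infty_of_hasFDerivAt {U : Set E} (hU : IsOpen U) {f : E → F}
    {α : E → E →L[ℝ] F} (hf : ∀ y ∈ U, HasFDerivAt f (α y) y)
    (hα : ∀ y ∈ U, ContDiffAt ℝ ∞ α y) {y : E} (hy : y ∈ U) : ContDiffAt ℝ ∞ f y := by
  refine ContDiffOn.contDiffAt ?_ (hU.mem_nhds hy)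
  rw [contDiffOn_infty_iff_fderiv_of_isOpen hU]
  exact ⟨fun z hz => (hf z hz).differentiableAt.differentiableWithinAt,
    fun z hz => (hα z hz).contDiffWithinAt.congr (fun x hx => (hf x hx).fderiv) (hf z hz).fderiv⟩

end Poincare

section RadialExtension

variable {n : ℕ} {F : Type*} [NormedAddCommGroup F] [NormedSpace ℝ F]

theorem hasFDerivAt_normalize (p : Sph n) :
    HasFDerivAt (fun y : Amb n => ‖y‖⁻¹ • y)
      (ContinuousLinearMap.id ℝ (Amb n) - (innerSL ℝ (p : Amb n)).smulRight (p : Amb n)) p := by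
  have hp : ‖(p : Amb n)‖ = 1 := by simp
  have hd : DifferentiableAt ℝ (fun y : Amb n => ‖y‖⁻¹ • y) p :=
    (((contDiffAt_norm (n := 1) ℝ (coe_ne_zero p)).inv (by simp)).smul
      contDiffAt_id).differentiableAt (by simp)
  refine hd.hasFDerivAt.congr_fderiv ?_
  ext1 v
  have h := fderiv_eq_of_norm_smul p (h := fun y : Amb n => y) hd
    (fun y hy => by rw [smul_smul, mul_inv_cancel₀ (by simpa using hy), one_smul]) v
  simp only [fderiv_fun_id, ContinuousLinearMap.id_apply, hp, inv_one, one_smul] at h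
  simp [eq_sub_iff_add_eq, ← h]

theorem fderiv_radialExt_of_restrict {f : Sph n → F} {h : Amb n → F} (hf : ∀ p : Sph n, f p = h p)
    (p : Sph n) (hh : DifferentiableAt ℝ h p) (v : Amb n) :
    fderiv ℝ (radialExt f) p v = fderiv ℝ h p (v - ⟪(p : Amb n), v⟫_ℝ • (p : Amb n)) := by
  have hcomp : radialExt f =ᶠ[nhds (p : Amb n)] h ∘ fun y => ‖y‖⁻¹ • y := by
    filter_upwards [isOpen_ne.mem_nhds (coe_ne_zero p)] with y hy
    obtain ⟨q, hq, hfq⟩ := exists_radial F hy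
    rw [hfq, hf, hq, Function.comp_apply]
  have hfd : HasFDerivAt h (fderiv ℝ h p) (‖(p : Amb n)‖⁻¹ • (p : Amb n)) := by
    rw [show ‖(p : Amb n)‖ = 1 by simp, inv_one, one_smul]
    exact hh.hasFDerivAt
  rw [hcomp.fderiv_eq, (HasFDerivAt.comp (f := fun y : Amb n => ‖y‖⁻¹ • y) (p : Amb n) hfd
    (hasFDerivAt_normalize p)).fderiv]
  simp

theorem fderiv_radialExt_of_restrict_of_inner_eq_zero {f : Sph n → F} {h : Amb n → F}
    (hf : ∀ p : Sph n, f p = h p) (p : Sph n) (hh : DifferentiableAt ℝ h p) {v : Amb n}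
    (hv : ⟪(p : Amb n), v⟫_ℝ = 0) : fderiv ℝ (radialExt f) p v = fderiv ℝ h p v := by
  rw [fderiv_radialExt_of_restrict hf p hh, hv, zero_smul, sub_zero]

theorem fderiv_radialExt_self (f : Sph n → F) {y : Amb n}
    (hd : DifferentiableAt ℝ (radialExt f) y) : fderiv ℝ (radialExt f) y y = 0 := by
  have hline : HasDerivAt (fun t : ℝ => t • y) y 1 := by
    simpa using (hasDerivAt_id (1 : ℝ)).smul_const y
  have hfd : HasFDerivAt (radialExt f) (fderiv ℝ (radialExt f) y) ((1 : ℝ) • y) := by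
    simpa using hd.hasFDerivAt
  have hconst : (fun t : ℝ => radialExt f (t • y)) =ᶠ[nhds 1] fun _ => radialExt f y := by
    filter_upwards [lt_mem_nhds (zero_lt_one' ℝ)] with t ht using radialExt_smul f ht y
  have hray : HasDerivAt (fun t : ℝ => radialExt f (t • y)) (fderiv ℝ (radialExt f) y y) 1 :=
    HasFDerivAt.comp_hasDerivAt (f := fun t : ℝ => t • y) 1 hfd hline
  exact hray.unique ((hasDerivAt_const 1 _).congr_of_eventuallyEq hconst)

/-- The restriction to the sphere of a function that is smooth away from the origin. -/
def restrictFun (h : Amb n → ℝ) (hh : ∀ y, y ≠ 0 → ContDiffAt ℝ ∞ h y) : SmoothFun n :=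
  ⟨fun p => h p, contMDiff_restrict hh⟩

end RadialExtension

namespace VF

variable {n : ℕ}

theorem inner_coe (X : VF n) (p : Sph n) : ⟪(p : Amb n), X.1 p⟫_ℝ = 0 := by
  rw [real_inner_comm]
  exact X.2 p

theorem ext0_coe (X : VF n) (p : Sph n) : X.ext0 p = X.1 p := radialExt_coe _ p

theorem differentiableAt_fun (f : SmoothFun n) (p : Sph n) :
    DifferentiableAt ℝ (radialExt f) p :=
  (smooth_fun f (coe_ne_zero p)).differentiableAt (by simp)

theorem lie_eq_of_restrict (X : VF n) {f : SmoothFun n} {h : Amb n → ℝ}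
    (hf : ∀ p : Sph n, f p = h p) (p : Sph n) (hh : DifferentiableAt ℝ h p) :
    ⁅X, f⁆ p = fderiv ℝ h p (X.1 p) := by
  rw [lie_fun_apply, ext0_coe,
    fderiv_radialExt_of_restrict_of_inner_eq_zero hf p hh (X.inner_coe p)]

theorem ext_of_lie {X Y : VF n} (h : ∀ f : SmoothFun n, ⁅X, f⁆ = ⁅Y, f⁆) : X = Y := by
  refine vf_ext fun p => ?_
  ext i
  have hs : ContDiff ℝ ∞ (EuclideanSpace.proj i : Amb n →L[ℝ] ℝ) := ContinuousLinearMap.contDiff _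
  have hi := DFunLike.congr_fun
    (h (restrictFun (EuclideanSpace.proj i : Amb n →L[ℝ] ℝ) fun _ _ => hs.contDiffAt)) p
  rwa [lie_eq_of_restrict X (fun _ => rfl) p (ContinuousLinearMap.differentiableAt _),
    lie_eq_of_restrict Y (fun _ => rfl) p (ContinuousLinearMap.differentiableAt _),
    ContinuousLinearMap.fderiv] at hi

theorem lie_mul (X : VF n) (f g : SmoothFun n) : ⁅X, f * g⁆ = f * ⁅X, g⁆ + g * ⁅X, f⁆ := by
  refine ContMDiffMap.ext fun p => ?_
  rw [lie_eq_of_restrict X (h := fun y => radialExt f y * radialExt g y)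
    (fun q => by simp [radialExt_coe]) p
    ((differentiableAt_fun f p).mul (differentiableAt_fun g p)),
    fderiv_fun_mul (differentiableAt_fun f p) (differentiableAt_fun g p)]
  simp [radialExt_coe, lie_fun_apply]

/-- The product of a function and a vector field. -/
def mulFun (f : SmoothFun n) (X : VF n) : VF n :=
  ⟨⟨fun p => f p • X.1 p, contMDiff_restrict (g := fun y => radialExt f y • X.ext0 y)
    (fun _ hy => (smooth_fun f hy).smul (X.smooth hy)) |>.congr fun p => by
      rw [radialExt_coe, ext0_coe]⟩, fun p => by
    change ⟪f p • X.1 p, (p : Amb n)⟫_ℝ = 0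
    rw [real_inner_smul_left, X.2 p, mul_zero]⟩

theorem mulFun_apply (f : SmoothFun n) (X : VF n) (p : Sph n) : (mulFun f X).1 p = f p • X.1 p :=
  rfl

theorem ext0_mulFun (f : SmoothFun n) (X : VF n) :
    (mulFun f X).ext0 = fun y => radialExt f y • X.ext0 y := by
  ext1 y
  by_cases hy : y = 0 <;> simp [radialExt, hy, mulFun_apply]

theorem mulFun_lie (f : SmoothFun n) (X : VF n) (g : SmoothFun n) :
    ⁅mulFun f X, g⁆ = f * ⁅X, g⁆ := by
  refine ContMDiffMap.ext fun p => ?_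
  rw [ContMDiffMap.coe_mul, Pi.mul_apply, lie_fun_apply, lie_fun_apply, ext0_coe, ext0_coe,
    mulFun_apply, map_smul, smul_eq_mul]

theorem div_mulFun (f : SmoothFun n) (X : VF n) (p : Sph n) :
    (mulFun f X).div p = f p * X.div p + ⁅X, f⁆ p := by
  rw [div_eq_traceL, ext0_mulFun,
    fderiv_fun_smul (differentiableAt_fun f p) (X.diff (coe_ne_zero p)), map_add, map_smul,
    ← div_eq_traceL, radialExt_coe, traceL_apply, lie_fun_apply, smul_eq_mul]
  congr 1
  exact LinearMap.trace_smulRight (fderiv ℝ (radialExt f) p : Amb n →ₗ[ℝ] ℝ) (X.ext0 p)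

/-- The gradient of a function on the round sphere. The Euclidean gradient of the extension is
already tangent to the sphere, since the extension is constant along rays. -/
def grad (f : SmoothFun n) : VF n :=
  ⟨⟨fun p => ∇ (radialExt f) p, contMDiff_restrict (g := ∇ (radialExt f)) fun y hy =>
    (InnerProductSpace.toDual ℝ (Amb n)).symm.contDiff.contDiffAt.comp y
      ((smooth_fun f hy).fderiv_right (m := ∞) (by simp))⟩, fun p => by
    change ⟪∇ (radialExt f) p, (p : Amb n)⟫_ℝ = 0
    rw [inner_gradient_left, fderiv_radialExt_self f (differentiableAt_fun f p)]⟩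

theorem inner_grad_apply (f : SmoothFun n) (p : Sph n) (v : Amb n) :
    ⟪(grad f).1 p, v⟫_ℝ = fderiv ℝ (radialExt f) p v :=
  inner_gradient_left ..

theorem lie_eq_inner_grad (X : VF n) (f : SmoothFun n) (p : Sph n) :
    ⁅X, f⁆ p = ⟪(grad f).1 p, X.1 p⟫_ℝ := by
  rw [inner_grad_apply, lie_fun_apply, ext0_coe]

/-- The pointwise inner product of two vector fields. -/
def innerFun (X Y : VF n) : SmoothFun n :=
  restrictFun (fun y => ⟪X.ext0 y, Y.ext0 y⟫_ℝ) fun _ hy => (X.smooth hy).inner ℝ (Y.smooth hy)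

theorem innerFun_apply (X Y : VF n) (p : Sph n) : innerFun X Y p = ⟪X.1 p, Y.1 p⟫_ℝ := by
  rw [← ext0_coe, ← ext0_coe]
  rfl

/-- The exterior derivative, at a point `p` and on tangent vectors `v, w ⟂ p`, of the one-form
dual to the vector field `W`. -/
def curl (W : VF n) (p : Sph n) (v w : Amb n) : ℝ :=
  ⟪fderiv ℝ W.ext0 p v, w⟫_ℝ - ⟪fderiv ℝ W.ext0 p w, v⟫_ℝ

/-- The one-form dual to the vector field `W` is closed. -/
def IsCurlFree (W : VF n) : Prop :=
  ∀ (p : Sph n) (v w : Amb n), ⟪(p : Amb n), v⟫_ℝ = 0 → ⟪(p : Amb n), w⟫_ℝ = 0 → W.curl p v w = 0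

theorem curl_apply_apply (W X Y : VF n) (p : Sph n) :
    W.curl p (X.1 p) (Y.1 p) =
      ⁅X, innerFun W Y⁆ p - ⁅Y, innerFun W X⁆ p - ⟪W.1 p, (⁅X, Y⁆ : VF n).1 p⟫_ℝ := by
  have lie_innerFun (X Y : VF n) : ⁅X, innerFun W Y⁆ p =
      ⟪fderiv ℝ W.ext0 p (X.1 p), Y.1 p⟫_ℝ + ⟪W.1 p, fderiv ℝ Y.ext0 p (X.1 p)⟫_ℝ := by
    have hW := W.diff (coe_ne_zero p)
    have hY := Y.diff (coe_ne_zero p)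
    rw [lie_eq_of_restrict X (h := fun y => ⟪W.ext0 y, Y.ext0 y⟫_ℝ) (fun _ => rfl) p
      (hW.inner ℝ hY), fderiv_inner_apply ℝ hW hY, ext0_coe, ext0_coe, add_comm]
  rw [curl, lie_innerFun, lie_innerFun, lie_apply, VectorField.lieBracket, inner_sub_right,
    ext0_coe, ext0_coe]
  ring

theorem IsCurlFree.curl_apply {W : VF n} (hW : W.IsCurlFree) (p : Sph n) (v w : Amb n) :
    W.curl p v w = ⟪(p : Amb n), v⟫_ℝ * ⟪W.1 p, w⟫_ℝ - ⟪(p : Amb n), w⟫_ℝ * ⟪W.1 p, v⟫_ℝ := by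
  have hpp : ⟪(p : Amb n), (p : Amb n)⟫_ℝ = 1 := by simp
  have htan (u : Amb n) : ⟪(p : Amb n), u - ⟪(p : Amb n), u⟫_ℝ • (p : Amb n)⟫_ℝ = 0 := by
    rw [inner_sub_right, real_inner_smul_right, hpp, mul_one, sub_self]
  have hrad : fderiv ℝ W.ext0 p p = 0 := fderiv_radialExt_self _ (W.diff (coe_ne_zero p))
  have h := hW p _ _ (htan v) (htan w)
  simp only [curl, map_sub, map_smul, hrad, smul_zero, sub_zero, inner_sub_right,
    real_inner_smul_right, inner_fderiv, ext0_coe] at h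
  rw [curl]
  linear_combination h

theorem fderiv_innerSL_ext0 (W : VF n) (p : Sph n) (v w : Amb n) :
    fderiv ℝ (fun y => innerSL ℝ (W.ext0 y)) p v w = ⟪fderiv ℝ W.ext0 p v, w⟫_ℝ := by
  have h := ((innerSL ℝ).hasFDerivAt.comp (p : Amb n) (W.diff (coe_ne_zero p)).hasFDerivAt).fderiv
  change fderiv ℝ (innerSL ℝ ∘ W.ext0) p v w = _
  rw [h, ContinuousLinearMap.comp_apply]
  exact innerSL_apply_apply ..

theorem isCurlFree_grad (f : SmoothFun n) : (grad f).IsCurlFree := by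
  intro p v w hv hw
  have hD : DifferentiableAt ℝ (fderiv ℝ (radialExt f)) p :=
    ((smooth_fun f (coe_ne_zero p)).fderiv_right (m := ∞) (by simp)).differentiableAt (by simp)
  have hext (y : Amb n) (hy : y ≠ 0) :
      innerSL ℝ ((grad f).ext0 y) = ‖y‖ • fderiv ℝ (radialExt f) y := by
    obtain ⟨q, hq, h⟩ := exists_radial (Amb n) hy
    ext1 u
    rw [ext0, h, innerSL_apply_apply, inner_grad_apply, hq,
      fderiv_radialExt_smul _ (by positivity), inv_inv]
  have hsnd (v w : Amb n) (hv : ⟪(p : Amb n), v⟫_ℝ = 0) :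
      ⟪fderiv ℝ (grad f).ext0 p v, w⟫_ℝ = fderiv ℝ (fderiv ℝ (radialExt f)) p v w := by
    rw [← fderiv_innerSL_ext0, fderiv_eq_of_norm_smul p hD hext, hv, zero_smul, add_zero]
  have hsymm : IsSymmSndFDerivAt ℝ (radialExt f) p :=
    (smooth_fun f (coe_ne_zero p)).isSymmSndFDerivAt (by simpa using two_le_smooth)
  rw [curl, hsnd v w hv, hsnd w v hw, hsymm.eq, sub_self]

/-- The closed one-form on `ℝⁿ⁺¹ ∖ {0}` that extends the dual of a curl-free field: the pullback
of the latter along `y ↦ y / |y|`, which explains the factor `|y|⁻¹`. -/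
def dualForm (W : VF n) (y : Amb n) : Amb n →L[ℝ] ℝ := ‖y‖⁻¹ • innerSL ℝ (W.ext0 y)

theorem contDiffAt_dualForm (W : VF n) {y : Amb n} (hy : y ≠ 0) : ContDiffAt ℝ ∞ W.dualForm y :=
  ((contDiffAt_norm ℝ hy).inv (by simpa using hy)).smul
    ((innerSL ℝ).contDiff.contDiffAt.comp y (W.smooth hy))

theorem dualForm_smul (W : VF n) {c : ℝ} (hc : 0 < c) (y : Amb n) :
    W.dualForm (c • y) = c⁻¹ • W.dualForm y := by
  rw [dualForm, dualForm, ext0, radialExt_smul _ hc, norm_smul, Real.norm_of_nonneg hc.le,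
    mul_inv, mul_smul]

theorem fderiv_dualForm_smul (W : VF n) {c : ℝ} (hc : 0 < c) (y : Amb n) :
    fderiv ℝ W.dualForm (c • y) = (c ^ 2)⁻¹ • fderiv ℝ W.dualForm y := by
  have h := fderiv_comp_smul (𝕜 := ℝ) (f := W.dualForm) (c := c) (x := y)
  have hfun : (fun x => W.dualForm (c • x)) = c⁻¹ • W.dualForm :=
    funext fun x => W.dualForm_smul hc x
  rw [hfun, fderiv_const_smul_field (f := W.dualForm) c⁻¹, Pi.smul_apply] at h
  rw [sq, mul_inv, mul_smul, h, inv_smul_smul₀ hc.ne']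

theorem IsCurlFree.fderiv_dualForm_symm {W : VF n} (hW : W.IsCurlFree) {y : Amb n} (hy : y ≠ 0)
    (v w : Amb n) : fderiv ℝ W.dualForm y v w = fderiv ℝ W.dualForm y w v := by
  obtain ⟨p, hp, -⟩ := exists_radial ℝ hy
  have hn : 0 < ‖y‖ := norm_pos_iff.2 hy
  have hd : DifferentiableAt ℝ W.dualForm p :=
    (W.contDiffAt_dualForm (coe_ne_zero p)).differentiableAt (by simp)
  have hD (v w : Amb n) : ⟪fderiv ℝ W.ext0 p v, w⟫_ℝ =
      fderiv ℝ W.dualForm p v w + ⟪(p : Amb n), v⟫_ℝ * ⟪W.1 p, w⟫_ℝ := by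
    rw [← fderiv_innerSL_ext0, fderiv_eq_of_norm_smul p hd fun z hz => by
      rw [dualForm, smul_inv_smul₀ (norm_ne_zero_iff.2 hz)]]
    simp [dualForm, ext0_coe]
  have hc := hW.curl_apply p v w
  rw [curl, hD, hD] at hc
  have hyp : y = ‖y‖ • (p : Amb n) := by rw [hp, smul_inv_smul₀ hn.ne']
  rw [hyp, W.fderiv_dualForm_smul hn]
  simp only [smul_apply, smul_eq_mul]
  linear_combination (‖y‖ ^ 2)⁻¹ * hc

theorem two_lt_rank_amb (hn : 2 ≤ n) : 2 < Module.rank ℝ (Amb n) := by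
  rw [rank_eq_card_basis (EuclideanSpace.basisFun (Fin (n + 1)) ℝ).toBasis, Fintype.card_fin]
  exact_mod_cast Nat.lt_succ_of_le hn

theorem isCurlFree_iff_exists_grad (hn : 2 ≤ n) {W : VF n} :
    W.IsCurlFree ↔ ∃ f : SmoothFun n, grad f = W := by
  refine ⟨fun hW => ?_, fun ⟨f, hf⟩ => hf ▸ isCurlFree_grad f⟩
  obtain ⟨f, hf⟩ := exists_primitive_compl_zero (two_lt_rank_amb hn)
    (fun y hy => (W.contDiffAt_dualForm hy).differentiableAt (by simp))
    fun y hy => hW.fderiv_dualForm_symm hy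
  refine ⟨restrictFun f fun y hy => contDiffAt_infty_of_hasFDerivAt isOpen_ne hf
    (fun z hz => W.contDiffAt_dualForm hz) hy, vf_ext fun p => ext_inner_right ℝ fun v => ?_⟩
  have hp := hf p (coe_ne_zero p)
  rw [inner_grad_apply,
    fderiv_radialExt_of_restrict (f := restrictFun f _) (fun _ => rfl) p hp.differentiableAt,
    hp.fderiv]
  simp [dualForm, ext0_coe, inner_sub_right, real_inner_smul_right, W.2 p]

end VF

section Cross

variable (a b c d : Amb 2)

theorem cross_comm : cross a b = -cross b a := by
  rw [cross, cross, ← WithLp.toLp_neg, cross_anticomm]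

theorem inner_cross_rotate : ⟪a, cross b c⟫_ℝ = ⟪b, cross c a⟫_ℝ := by
  simp [cross, cross_apply, PiLp.inner_apply, Fin.sum_univ_three]
  ring

theorem inner_cross_self_left : ⟪a, cross a b⟫_ℝ = 0 := by
  simp [cross, cross_apply, PiLp.inner_apply, Fin.sum_univ_three]
  ring

theorem cross_cross : cross a (cross b c) = ⟪a, c⟫_ℝ • b - ⟪a, b⟫_ℝ • c := by
  ext i
  fin_cases i <;>
    simp [cross, cross_apply, PiLp.inner_apply, Fin.sum_univ_three] <;> ring

theorem inner_cross_cross :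
    ⟪cross a b, cross c d⟫_ℝ = ⟪a, c⟫_ℝ * ⟪b, d⟫_ℝ - ⟪a, d⟫_ℝ * ⟪b, c⟫_ℝ := by
  simp [cross, cross_apply, PiLp.inner_apply, Fin.sum_univ_three]
  ring

theorem inner_cross_smul : ⟪a, cross b c⟫_ℝ • d =
    ⟪d, a⟫_ℝ • cross b c + ⟪d, b⟫_ℝ • cross c a + ⟪d, c⟫_ℝ • cross a b := by
  ext i
  fin_cases i <;>
    simp [cross, cross_apply, PiLp.inner_apply, Fin.sum_univ_three] <;> ring

variable {a b c} in
theorem inner_cross_eq_zero (p : Sph 2) (ha : ⟪(p : Amb 2), a⟫_ℝ = 0)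
    (hb : ⟪(p : Amb 2), b⟫_ℝ = 0) (hc : ⟪(p : Amb 2), c⟫_ℝ = 0) : ⟪a, cross b c⟫_ℝ = 0 := by
  have h := inner_cross_smul a b c p
  rw [ha, hb, hc, zero_smul, zero_smul, zero_smul, add_zero, add_zero, smul_eq_zero] at h
  exact h.resolve_right (coe_ne_zero p)

theorem trace_mul_inner_cross (A : Amb 2 →ₗ[ℝ] Amb 2) :
    LinearMap.trace ℝ (Amb 2) A * ⟪a, cross b c⟫_ℝ =
      ⟪A a, cross b c⟫_ℝ + ⟪a, cross (A b) c⟫_ℝ + ⟪a, cross b (A c)⟫_ℝ := by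
  let e := EuclideanSpace.basisFun (Fin 3) ℝ
  have hA (v : Amb 2) : A v = v 0 • A (e 0) + v 1 • A (e 1) + v 2 • A (e 2) := by
    conv_lhs => rw [← e.sum_repr v]
    simp [Fin.sum_univ_three, e]
  rw [A.trace_eq_sum_inner e, hA a, hA b, hA c]
  simp [e, cross, cross_apply, PiLp.inner_apply, Fin.sum_univ_three]
  ring

/-- The cross product as a continuous bilinear map. -/
def crossL : Amb 2 →L[ℝ] Amb 2 →L[ℝ] Amb 2 :=
  (LinearMap.mk₂ ℝ cross (fun _ _ _ => by simp [cross]) (fun _ _ _ => by simp [cross])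
    (fun _ _ _ => by simp [cross]) fun _ _ _ => by simp [cross]).toContinuousBilinearMap

theorem crossL_apply : crossL a b = cross a b := rfl

end Cross

namespace VF

/-- The vector field `v` rotated by `-90°`, an almost complex structure on `S²`. -/
def rotate (v : VF 2) : VF 2 :=
  ⟨⟨fun p => cross (v.1 p) p, contMDiff_restrict (g := fun y => cross (v.ext0 y) y)
    (fun _ hy => smooth_cross (v.smooth hy) contDiffAt_id) |>.congr fun p => by rw [ext0_coe]⟩,
    fun p => by
      change ⟪cross (v.1 p) p, (p : Amb 2)⟫_ℝ = 0
      rw [real_inner_comm, cross_comm, inner_neg_right, inner_cross_self_left, neg_zero]⟩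

theorem rotate_apply (v : VF 2) (p : Sph 2) : v.rotate.1 p = cross (v.1 p) p := rfl

theorem curl_rotate (v : VF 2) (p : Sph 2) {u w : Amb 2} (hu : ⟪(p : Amb 2), u⟫_ℝ = 0)
    (hw : ⟪(p : Amb 2), w⟫_ℝ = 0) :
    v.rotate.curl p u w = -(v.div p * ⟪(p : Amb 2), cross u w⟫_ℝ) := by
  have hD (u w : Amb 2) (hu : ⟪(p : Amb 2), u⟫_ℝ = 0) (hw : ⟪(p : Amb 2), w⟫_ℝ = 0) :
      ⟪fderiv ℝ v.rotate.ext0 p u, w⟫_ℝ = -⟪(p : Amb 2), cross (fderiv ℝ v.ext0 p u) w⟫_ℝ := by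
    have h := crossL.hasFDerivAt_of_bilinear (v.diff (coe_ne_zero p)).hasFDerivAt
      (hasFDerivAt_id (p : Amb 2))
    have hcross : fderiv ℝ v.rotate.ext0 p u =
        cross (v.1 p) u + cross (fderiv ℝ v.ext0 p u) p := by
      rw [ext0, fderiv_radialExt_of_restrict_of_inner_eq_zero (f := v.rotate.1)
        (fun q => by rw [ext0_coe]; rfl) p h.differentiableAt hu, h.fderiv]
      simp [crossL_apply, ext0_coe]
    rw [hcross, inner_add_left, real_inner_comm, real_inner_comm w,
      inner_cross_eq_zero p hw (v.inner_coe p) hu, zero_add, ← inner_cross_rotate, cross_comm,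
      inner_neg_right]
  have hrad : fderiv ℝ v.ext0 p p = 0 := fderiv_radialExt_self _ (v.diff (coe_ne_zero p))
  have htr := trace_mul_inner_cross (p : Amb 2) u w (fderiv ℝ v.ext0 p : Amb 2 →ₗ[ℝ] Amb 2)
  simp only [ContinuousLinearMap.coe_coe, hrad, inner_zero_left, zero_add] at htr
  rw [curl, hD u w hu hw, hD w u hw hu, cross_comm _ u, inner_neg_right, div, htr]
  ring

theorem exists_ne_zero_inner_eq_zero (p : Sph 2) : ∃ u : Amb 2, u ≠ 0 ∧ ⟪(p : Amb 2), u⟫_ℝ = 0 := by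
  have := Fact.mk (@finrank_euclideanSpace_fin ℝ _ (2 + 1))
  have : Nontrivial (ℝ ∙ (p : Amb 2))ᗮ := Module.nontrivial_of_finrank_pos (R := ℝ)
    (by rw [Submodule.finrank_orthogonal_span_singleton (n := 2) (coe_ne_zero p)]; exact two_pos)
  obtain ⟨u, hu⟩ := exists_ne (0 : (ℝ ∙ (p : Amb 2))ᗮ)
  exact ⟨u, Subtype.coe_ne_coe.2 hu, Submodule.mem_orthogonal_singleton_iff_inner_right.1 u.2⟩

theorem mem_divFree_iff_isCurlFree_rotate {v : VF 2} : v ∈ divFree 2 ↔ v.rotate.IsCurlFree := by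
  refine ⟨fun hv p u w hu hw => ?_, fun hv p => ?_⟩
  · rw [curl_rotate v p hu hw, hv p, zero_mul, neg_zero]
  · obtain ⟨u, hu0, hu⟩ := exists_ne_zero_inner_eq_zero p
    have hw := inner_cross_self_left (p : Amb 2) u
    have h := hv p u (cross p u) hu hw
    have harea : ⟪(p : Amb 2), cross u (cross p u)⟫_ℝ ≠ 0 := by
      rw [cross_cross, inner_sub_right, real_inner_smul_right, real_inner_smul_right, hu]
      simpa using hu0
    rw [curl_rotate v p hu hw, neg_eq_zero] at h
    exact (mul_eq_zero.1 h).resolve_right harea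

end VF

theorem eq_hamField_iff {v : VF 2} {ψ : SmoothFun 2} : v = hamField ψ ↔ VF.grad ψ = v.rotate := by
  have hham (p : Sph 2) : (hamField ψ).1 p = cross p ((VF.grad ψ).1 p) := rfl
  have hpp (p : Sph 2) : ⟪(p : Amb 2), (p : Amb 2)⟫_ℝ = 1 := by simp
  constructor
  · rintro rfl
    refine VF.vf_ext fun p => ?_
    rw [VF.rotate_apply, hham, cross_comm, cross_cross, hpp, VF.inner_coe, one_smul, zero_smul,
      zero_sub, neg_neg]
  · intro h
    refine VF.vf_ext fun p => ?_
    rw [hham, h, VF.rotate_apply, cross_cross, hpp, VF.inner_coe, one_smul, zero_smul, sub_zero]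

theorem mem_divFree_two_iff {v : VF 2} : v ∈ divFree 2 ↔ ∃ ψ : SmoothFun 2, v = hamField ψ := by
  rw [VF.mem_divFree_iff_isCurlFree_rotate, VF.isCurlFree_iff_exists_grad le_rfl]
  exact exists_congr fun ψ => eq_hamField_iff.symm

theorem poisson_apply (f h : SmoothFun 2) (p : Sph 2) :
    poisson f h p = ⟪(p : Amb 2), cross ((VF.grad f).1 p) ((VF.grad h).1 p)⟫_ℝ := rfl

theorem lie_hamField (ψ σ : SmoothFun 2) : ⁅hamField ψ, σ⁆ = poisson ψ σ := by
  refine ContMDiffMap.ext fun p => ?_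
  rw [VF.lie_eq_inner_grad, poisson_apply, inner_cross_rotate, inner_cross_rotate]
  rfl

theorem poisson_skew (f h : SmoothFun 2) : -poisson h f = poisson f h := by
  refine ContMDiffMap.ext fun p => ?_
  rw [ContMDiffMap.coe_neg, Pi.neg_apply, poisson_apply, poisson_apply, cross_comm, inner_neg_right,
    neg_neg]

theorem poisson_self (f : SmoothFun 2) : poisson f f = 0 := by
  refine ContMDiffMap.ext fun p => ?_
  rw [poisson_apply, cross, cross_self, WithLp.toLp_zero, inner_zero_right]
  rfl

section LinearField

variable (A B : Amb 3 →ₗ[ℝ] Amb 3) (hA : ∀ y, ⟪A y, y⟫_ℝ = 0) (hB : ∀ y, ⟪B y, y⟫_ℝ = 0)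

theorem linearField_apply (p : Sph 3) : (linearField A hA).1 p = A p := rfl

theorem fderiv_ext0_linearField (p : Sph 3) (v : Amb 3) :
    fderiv ℝ (linearField A hA).ext0 p v = A v - ⟪(p : Amb 3), v⟫_ℝ • A p := by
  have h : HasFDerivAt (fun y => A y) (LinearMap.toContinuousLinearMap A) p :=
    (LinearMap.toContinuousLinearMap A).hasFDerivAt
  rw [VF.ext0, fderiv_radialExt_of_restrict (linearField_apply A hA) p h.differentiableAt, h.fderiv]
  simp

theorem lie_linearField (p : Sph 3) :
    (⁅linearField A hA, linearField B hB⁆ : VF 3).1 p = B (A p) - A (B p) := by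
  rw [VF.lie_apply, VectorField.lieBracket, fderiv_ext0_linearField, fderiv_ext0_linearField,
    VF.ext0_coe, VF.ext0_coe, VF.inner_coe, VF.inner_coe]
  simp [linearField_apply]

theorem div_linearField (p : Sph 3) : (linearField A hA).div p = 0 := by
  have h (v : Amb 3) : ⟪v, fderiv ℝ (linearField A hA).ext0 p v⟫_ℝ =
      -(⟪(p : Amb 3), v⟫_ℝ * ⟪v, A p⟫_ℝ) := by
    rw [fderiv_ext0_linearField, inner_sub_right, real_inner_comm, hA, real_inner_smul_right,
      zero_sub]
  rw [VF.div, LinearMap.trace_eq_sum_inner _ (EuclideanSpace.basisFun (Fin 4) ℝ)]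
  refine (Finset.sum_congr rfl fun i _ => h _).trans ?_
  rw [Finset.sum_neg_distrib, OrthonormalBasis.sum_inner_mul_inner, real_inner_comm, hA, neg_zero]

end LinearField

/-- The linear maps of `ℝ⁴` whose restrictions to `S³` are `E₁`, `E₂`, `E₃`. -/
def frame : Fin 3 → Amb 3 →ₗ[ℝ] Amb 3 :=
  ![Matrix.toEuclideanLin matE1, Matrix.toEuclideanLin matE2, Matrix.toEuclideanLin matE3]

theorem frame_zero (y : Amb 3) : frame 0 y = !₂[y 3 / 2, -y 2 / 2, y 1 / 2, -y 0 / 2] := by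
  ext i
  fin_cases i <;> simp [frame, matE1, Matrix.toLpLin_apply, dotProduct, Fin.sum_univ_four] <;> ring

theorem frame_one (y : Amb 3) : frame 1 y = !₂[y 2 / 2, y 3 / 2, -y 0 / 2, -y 1 / 2] := by
  ext i
  fin_cases i <;> simp [frame, matE2, Matrix.toLpLin_apply, dotProduct, Fin.sum_univ_four] <;> ring

theorem frame_two (y : Amb 3) : frame 2 y = !₂[-y 1 / 2, y 0 / 2, y 3 / 2, -y 2 / 2] := by
  ext i
  fin_cases i <;> simp [frame, matE3, Matrix.toLpLin_apply, dotProduct, Fin.sum_univ_four] <;> ring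

theorem E1_apply (p : Sph 3) : E1.1 p = frame 0 p := rfl
theorem E2_apply (p : Sph 3) : E2.1 p = frame 1 p := rfl
theorem E3_apply (p : Sph 3) : E3.1 p = frame 2 p := rfl

theorem inner_amb3 (v w : Amb 3) :
    ⟪v, w⟫_ℝ = v 0 * w 0 + v 1 * w 1 + v 2 * w 2 + v 3 * w 3 := by
  simp [PiLp.inner_apply, Fin.sum_univ_four]; ring

theorem norm_sq_amb3 (v : Amb 3) : ‖v‖ ^ 2 = v 0 ^ 2 + v 1 ^ 2 + v 2 ^ 2 + v 3 ^ 2 := by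
  rw [EuclideanSpace.norm_sq_eq, Fin.sum_univ_four]; simp

theorem inner_frame (i j : Fin 3) (y : Amb 3) :
    ⟪frame i y, frame j y⟫_ℝ = if i = j then ‖y‖ ^ 2 / 4 else 0 := by
  rw [inner_amb3, norm_sq_amb3]
  fin_cases i <;> fin_cases j <;> simp [frame_zero, frame_one, frame_two] <;> ring

theorem norm_sq_smul_eq_frame (y v : Amb 3) :
    ‖y‖ ^ 2 • v = ⟪y, v⟫_ℝ • y + (4 * ⟪frame 0 y, v⟫_ℝ) • frame 0 y
      + (4 * ⟪frame 1 y, v⟫_ℝ) • frame 1 y + (4 * ⟪frame 2 y, v⟫_ℝ) • frame 2 y := by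
  simp only [inner_amb3, norm_sq_amb3]
  ext i
  fin_cases i <;> simp [frame_zero, frame_one, frame_two] <;> ring

theorem eq_frame_of_inner_eq_zero {p : Sph 3} {v : Amb 3} (hv : ⟪(p : Amb 3), v⟫_ℝ = 0) :
    v = (4 * ⟪frame 0 p, v⟫_ℝ) • frame 0 p + (4 * ⟪frame 1 p, v⟫_ℝ) • frame 1 p
      + (4 * ⟪frame 2 p, v⟫_ℝ) • frame 2 p := by
  simpa [hv] using norm_sq_smul_eq_frame p v

theorem lie_E1_E2 : ⁅E1, E2⁆ = -E3 := VF.vf_ext fun p => by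
  refine (lie_linearField ..).trans ?_
  change frame 1 (frame 0 p) - frame 0 (frame 1 p) = -frame 2 p
  ext i
  fin_cases i <;> simp [frame_zero, frame_one, frame_two] <;> ring

theorem lie_E2_E3 : ⁅E2, E3⁆ = -E1 := VF.vf_ext fun p => by
  refine (lie_linearField ..).trans ?_
  change frame 2 (frame 1 p) - frame 1 (frame 2 p) = -frame 0 p
  ext i
  fin_cases i <;> simp [frame_zero, frame_one, frame_two] <;> ring

theorem lie_E1_E3 : ⁅E1, E3⁆ = E2 := VF.vf_ext fun p => by
  refine (lie_linearField ..).trans ?_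
  change frame 2 (frame 0 p) - frame 0 (frame 2 p) = frame 1 p
  ext i
  fin_cases i <;> simp [frame_zero, frame_one, frame_two] <;> ring

theorem lie_E1_lie_E2 (f : SmoothFun 3) : ⁅E1, ⁅E2, f⁆⁆ = ⁅E2, ⁅E1, f⁆⁆ - ⁅E3, f⁆ := by
  rw [leibniz_lie, lie_E1_E2, neg_lie]; abel

theorem lie_E1_lie_E3 (f : SmoothFun 3) : ⁅E1, ⁅E3, f⁆⁆ = ⁅E3, ⁅E1, f⁆⁆ + ⁅E2, f⁆ := by
  rw [leibniz_lie, lie_E1_E3]; abel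

theorem lie_E3_lie_E2 (f : SmoothFun 3) : ⁅E3, ⁅E2, f⁆⁆ = ⁅E2, ⁅E3, f⁆⁆ + ⁅E1, f⁆ := by
  rw [leibniz_lie E2, lie_E2_E3, neg_lie]; abel

theorem VF.isCurlFree_of_frame {W : VF 3} (h₁₂ : ∀ p, W.curl p (E1.1 p) (E2.1 p) = 0)
    (h₁₃ : ∀ p, W.curl p (E1.1 p) (E3.1 p) = 0) (h₂₃ : ∀ p, W.curl p (E2.1 p) (E3.1 p) = 0) :
    W.IsCurlFree := by
  intro p v w hv hw
  have h₁₂ := h₁₂ p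
  have h₁₃ := h₁₃ p
  have h₂₃ := h₂₃ p
  simp only [VF.curl, E1_apply, E2_apply, E3_apply] at h₁₂ h₁₃ h₂₃
  rw [VF.curl, eq_frame_of_inner_eq_zero hv, eq_frame_of_inner_eq_zero hw]
  generalize 4 * ⟪frame 0 p, v⟫_ℝ = v₁, 4 * ⟪frame 1 p, v⟫_ℝ = v₂, 4 * ⟪frame 2 p, v⟫_ℝ = v₃,
    4 * ⟪frame 0 p, w⟫_ℝ = w₁, 4 * ⟪frame 1 p, w⟫_ℝ = w₂, 4 * ⟪frame 2 p, w⟫_ℝ = w₃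
  simp only [map_add, map_smul, inner_add_left, inner_add_right, real_inner_smul_left,
    real_inner_smul_right]
  linear_combination (v₁ * w₂ - v₂ * w₁) * h₁₂ + (v₁ * w₃ - v₃ * w₁) * h₁₃
    + (v₂ * w₃ - v₃ * w₂) * h₂₃

/-- The vector field `c₁ E₁ + c₂ E₂ + c₃ E₃`. -/
def frameField (c₁ c₂ c₃ : SmoothFun 3) : VF 3 :=
  VF.mulFun c₁ E1 + VF.mulFun c₂ E2 + VF.mulFun c₃ E3

section FrameField

variable (c₁ c₂ c₃ : SmoothFun 3)

theorem frameField_apply (p : Sph 3) : (frameField c₁ c₂ c₃).1 p =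
    c₁ p • frame 0 p + c₂ p • frame 1 p + c₃ p • frame 2 p := rfl

theorem inner_frameField_frame (p : Sph 3) (i : Fin 3) :
    ⟪(frameField c₁ c₂ c₃).1 p, frame i p⟫_ℝ = ![c₁, c₂, c₃] i p / 4 := by
  simp only [frameField_apply, inner_add_left, real_inner_smul_left, inner_frame]
  fin_cases i <;> simp [div_eq_mul_inv]

theorem frameField_lie (f : SmoothFun 3) :
    ⁅frameField c₁ c₂ c₃, f⁆ = c₁ * ⁅E1, f⁆ + c₂ * ⁅E2, f⁆ + c₃ * ⁅E3, f⁆ := by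
  rw [frameField, add_lie, add_lie, VF.mulFun_lie, VF.mulFun_lie, VF.mulFun_lie]

theorem div_frameField (p : Sph 3) :
    (frameField c₁ c₂ c₃).div p = (⁅E1, c₁⁆ + ⁅E2, c₂⁆ + ⁅E3, c₃⁆ : SmoothFun 3) p := by
  rw [frameField, VF.div_add, VF.div_add, VF.div_mulFun, VF.div_mulFun, VF.div_mulFun, E1, E2, E3,
    div_linearField, div_linearField, div_linearField]
  simp

variable {c₁ c₂ c₃}

theorem frameField_inj {d₁ d₂ d₃ : SmoothFun 3} :
    frameField c₁ c₂ c₃ = frameField d₁ d₂ d₃ ↔ c₁ = d₁ ∧ c₂ = d₂ ∧ c₃ = d₃ := by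
  refine ⟨fun h => ?_, by rintro ⟨rfl, rfl, rfl⟩; rfl⟩
  have hi (i : Fin 3) : ![c₁, c₂, c₃] i = ![d₁, d₂, d₃] i := ContMDiffMap.ext fun p => by
    have := inner_frameField_frame c₁ c₂ c₃ p i
    rw [h, inner_frameField_frame] at this
    linarith
  exact ⟨hi 0, hi 1, hi 2⟩

theorem exists_eq_frameField (u : VF 3) : ∃ c₁ c₂ c₃, u = frameField c₁ c₂ c₃ :=
  ⟨(4 : ℝ) • VF.innerFun E1 u, (4 : ℝ) • VF.innerFun E2 u, (4 : ℝ) • VF.innerFun E3 u,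
    VF.vf_ext fun p => by
      simp only [frameField_apply, ContMDiffMap.coe_smul, Pi.smul_apply, VF.innerFun_apply]
      exact eq_frame_of_inner_eq_zero (u.inner_coe p)⟩

theorem lie_E1_frameField : ⁅E1, frameField c₁ c₂ c₃⁆ =
    frameField ⁅E1, c₁⁆ (⁅E1, c₂⁆ + c₃) (⁅E1, c₃⁆ - c₂) := by
  refine VF.ext_of_lie fun f => ?_
  rw [lie_lie, frameField_lie, frameField_lie, frameField_lie, lie_add, lie_add, VF.lie_mul,
    VF.lie_mul, VF.lie_mul, lie_E1_lie_E2, lie_E1_lie_E3]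
  ring

/-- The field `σ E₁ - (E₃ ψ) E₂ + (E₂ ψ) E₃`. -/
def formField (σ ψ : SmoothFun 3) : VF 3 := frameField σ (-⁅E3, ψ⁆) ⁅E2, ψ⁆

theorem hasForm_iff {u : VF 3} {σ ψ : SmoothFun 3} : HasForm u σ ψ ↔ u = formField σ ψ := by
  have happly (p : Sph 3) : (formField σ ψ).1 p =
      σ p • E1.1 p - ⁅E3, ψ⁆ p • E2.1 p + ⁅E2, ψ⁆ p • E3.1 p := by
    rw [formField, frameField_apply, sub_eq_add_neg, ← neg_smul]
    rfl
  exact ⟨fun h => VF.vf_ext fun p => (h p).trans (happly p).symm, fun h p => h ▸ happly p⟩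

theorem frameField_mem_divFree_iff :
    frameField c₁ c₂ c₃ ∈ divFree 3 ↔ ⁅E1, c₁⁆ + ⁅E2, c₂⁆ + ⁅E3, c₃⁆ = 0 :=
  ⟨fun h => ContMDiffMap.ext fun p => (div_frameField c₁ c₂ c₃ p).symm.trans (h p),
    fun h p => by rw [div_frameField, h]; rfl⟩

theorem lie_E1_frameField_eq_zero_iff : ⁅E1, frameField c₁ c₂ c₃⁆ = 0 ↔
    ⁅E1, c₁⁆ = 0 ∧ ⁅E1, c₂⁆ = -c₃ ∧ ⁅E1, c₃⁆ = c₂ := by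
  have hz : (0 : VF 3) = frameField 0 0 0 := VF.vf_ext fun p => by
    rw [frameField_apply]
    simp
  rw [lie_E1_frameField, hz, frameField_inj, sub_eq_zero, eq_neg_iff_add_eq_zero]

theorem frameField_mem_hopfDivFree_iff : frameField c₁ c₂ c₃ ∈ hopfDivFree ↔
    ⁅E1, c₁⁆ = 0 ∧ ⁅E1, c₂⁆ = -c₃ ∧ ⁅E1, c₃⁆ = c₂ ∧ ⁅E2, c₂⁆ + ⁅E3, c₃⁆ = 0 := by
  change frameField c₁ c₂ c₃ ∈ divFree 3 ∧ _ = 0 ↔ _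
  rw [frameField_mem_divFree_iff, lie_E1_frameField_eq_zero_iff]
  constructor
  · rintro ⟨h, h₁, h₂, h₃⟩
    exact ⟨h₁, h₂, h₃, by rwa [h₁, zero_add] at h⟩
  · rintro ⟨h₁, h₂, h₃, h⟩
    exact ⟨by rw [h₁, zero_add, h], h₁, h₂, h₃⟩

theorem exists_potential {a b : SmoothFun 3} (h₁ : ⁅E1, a⁆ = -b) (h₂ : ⁅E1, b⁆ = a)
    (h₃ : ⁅E2, b⁆ = ⁅E3, a⁆) : ∃ ψ : SmoothFun 3, ⁅E1, ψ⁆ = 0 ∧ ⁅E2, ψ⁆ = a ∧ ⁅E3, ψ⁆ = b := by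
  let W : VF 3 := frameField 0 ((4 : ℝ) • a) ((4 : ℝ) • b)
  have hW (p : Sph 3) (i : Fin 3) : ⟪W.1 p, frame i p⟫_ℝ = ![0, a, b] i p := by
    rw [inner_frameField_frame]
    fin_cases i <;> simp
  have hW₁ : VF.innerFun W E1 = 0 := ContMDiffMap.ext fun p =>
    (W.innerFun_apply E1 p).trans (hW p 0)
  have hW₂ : VF.innerFun W E2 = a := ContMDiffMap.ext fun p =>
    (W.innerFun_apply E2 p).trans (hW p 1)
  have hW₃ : VF.innerFun W E3 = b := ContMDiffMap.ext fun p =>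
    (W.innerFun_apply E3 p).trans (hW p 2)
  have hclosed : W.IsCurlFree := VF.isCurlFree_of_frame
    (fun p => by
      rw [VF.curl_apply_apply, hW₁, hW₂, lie_E1_E2, lie_zero, h₁]
      change -b p - 0 - ⟪W.1 p, -frame 2 p⟫_ℝ = 0
      rw [inner_neg_right, hW]
      simp)
    (fun p => by
      rw [VF.curl_apply_apply, hW₁, hW₃, lie_E1_E3, lie_zero, h₂, E2_apply, hW]
      simp)
    (fun p => by
      rw [VF.curl_apply_apply, hW₂, hW₃, lie_E2_E3, h₃]
      change _ - _ - ⟪W.1 p, -frame 0 p⟫_ℝ = 0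
      rw [inner_neg_right, hW]
      simp)
  obtain ⟨ψ, hψ⟩ := (VF.isCurlFree_iff_exists_grad (by norm_num)).1 hclosed
  have hlie (X : VF 3) : ⁅X, ψ⁆ = VF.innerFun W X := ContMDiffMap.ext fun p => by
    rw [VF.lie_eq_inner_grad, hψ, VF.innerFun_apply]
  exact ⟨ψ, by rw [hlie, hW₁], by rw [hlie, hW₂], by rw [hlie, hW₃]⟩

end FrameField

theorem mem_hopfDivFree_iff {u : VF 3} : u ∈ hopfDivFree ↔
    ∃ σ ψ : SmoothFun 3, ⁅E1, σ⁆ = 0 ∧ ⁅E1, ψ⁆ = 0 ∧ HasForm u σ ψ := by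
  simp only [hasForm_iff, formField]
  constructor
  · intro hu
    obtain ⟨c₁, c₂, c₃, rfl⟩ := exists_eq_frameField u
    obtain ⟨h₁, h₂, h₃, h₄⟩ := frameField_mem_hopfDivFree_iff.1 hu
    obtain ⟨ψ, hψ₁, hψ₂, hψ₃⟩ := exists_potential (a := c₃) (b := -c₂) (by rw [h₃, neg_neg])
      (by rw [lie_neg, h₂, neg_neg]) (by rw [lie_neg, neg_eq_iff_add_eq_zero, h₄])
    exact ⟨c₁, ψ, h₁, hψ₁, by rw [hψ₂, hψ₃, neg_neg]⟩
  · rintro ⟨σ, ψ, hσ, hψ, rfl⟩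
    refine frameField_mem_hopfDivFree_iff.2 ⟨hσ, ?_, ?_, ?_⟩
    · rw [lie_neg, lie_E1_lie_E3, hψ, lie_zero, zero_add]
    · rw [lie_E1_lie_E2, hψ, lie_zero, zero_sub]
    · rw [lie_E3_lie_E2, hψ, lie_neg, add_zero, neg_add_cancel]

section HopfDerivative

theorem differentiable_hopfAmb : Differentiable ℝ hopfAmb := by
  rw [differentiable_euclidean]
  intro i
  fin_cases i <;> simp only [hopfAmb] <;> dsimp <;> fun_prop

theorem fderiv_hopfAmb (q v : Amb 3) : fderiv ℝ hopfAmb q v =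
    !₂[2 * (q 3 * v 3 + q 0 * v 0 - q 1 * v 1 - q 2 * v 2),
      2 * (q 0 * v 1 + q 1 * v 0 - q 3 * v 2 - q 2 * v 3),
      2 * (q 0 * v 2 + q 2 * v 0 + q 3 * v 1 + q 1 * v 3)] := by
  have h (i : Fin 4) := (EuclideanSpace.proj i : Amb 3 →L[ℝ] ℝ).hasFDerivAt (x := q)
  have hsq := ((((h 3).pow 2).add ((h 0).pow 2)).sub ((h 1).pow 2)).sub ((h 2).pow 2)
  have hmul₁ := (((h 0).mul (h 1)).sub ((h 3).mul (h 2))).const_mul 2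
  have hmul₂ := (((h 0).mul (h 2)).add ((h 3).mul (h 1))).const_mul 2
  have hcoord (i : Fin 3) := ((EuclideanSpace.proj i : Amb 2 →L[ℝ] ℝ).hasFDerivAt.comp q
    (differentiable_hopfAmb q).hasFDerivAt)
  ext i
  fin_cases i
  · exact (DFunLike.congr_fun ((hcoord 0).unique hsq) v).trans (by simp; ring)
  · exact (DFunLike.congr_fun ((hcoord 1).unique hmul₁) v).trans (by simp; ring)
  · exact (DFunLike.congr_fun ((hcoord 2).unique hmul₂) v).trans (by simp; ring)

theorem fderiv_hopfAmb_frame_zero (q : Amb 3) : fderiv ℝ hopfAmb q (frame 0 q) = 0 := by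
  rw [fderiv_hopfAmb, frame_zero]
  ext i
  fin_cases i <;> simp <;> ring

theorem cross_fderiv_hopfAmb_frame (q : Amb 3) :
    cross (fderiv ℝ hopfAmb q (frame 1 q)) (fderiv ℝ hopfAmb q (frame 2 q)) =
      ‖q‖ ^ 2 • hopfAmb q := by
  rw [fderiv_hopfAmb, fderiv_hopfAmb, frame_one, frame_two, norm_sq_amb3]
  ext i
  fin_cases i <;> simp [cross, cross_apply, hopfAmb] <;> ring

end HopfDerivative

theorem hopf_coe (p : Sph 3) : (hopf p : Amb 2) = hopfAmb p := rfl

section HopfPullback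

variable (f h ψ χ : SmoothFun 2)

theorem lie_hopfPullback (X : VF 3) (p : Sph 3) :
    ⁅X, hopfPullback f⁆ p = ⟪(VF.grad f).1 (hopf p), fderiv ℝ hopfAmb p (X.1 p)⟫_ℝ := by
  have hf : HasFDerivAt (radialExt f) (fderiv ℝ (radialExt f) (hopf p)) (hopfAmb p) :=
    (VF.differentiableAt_fun f (hopf p)).hasFDerivAt
  have hcomp := hf.comp (p : Amb 3) (differentiable_hopfAmb p).hasFDerivAt
  rw [VF.lie_eq_of_restrict X (h := radialExt f ∘ hopfAmb)
    (fun p => (radialExt_coe f (hopf p)).symm) p hcomp.differentiableAt, hcomp.fderiv,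
    VF.inner_grad_apply]
  rfl

theorem lie_E1_hopfPullback : ⁅E1, hopfPullback f⁆ = 0 := by
  refine ContMDiffMap.ext fun p => ?_
  rw [lie_hopfPullback, E1_apply, fderiv_hopfAmb_frame_zero, inner_zero_right]
  rfl

theorem hopfPullback_poisson : hopfPullback (poisson f h) =
    ⁅E2, hopfPullback f⁆ * ⁅E3, hopfPullback h⁆ - ⁅E3, hopfPullback f⁆ * ⁅E2, hopfPullback h⁆ := by
  refine ContMDiffMap.ext fun p => ?_
  have hnormal := cross_fderiv_hopfAmb_frame (p : Amb 3)
  rw [norm_eq_of_mem_sphere, one_pow, one_smul, ← hopf_coe] at hnormal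
  change poisson f h (hopf p) = ⁅E2, hopfPullback f⁆ p * ⁅E3, hopfPullback h⁆ p
    - ⁅E3, hopfPullback f⁆ p * ⁅E2, hopfPullback h⁆ p
  rw [poisson_apply, ← hnormal, inner_cross_cross]
  rw [lie_hopfPullback, lie_hopfPullback, lie_hopfPullback, lie_hopfPullback, E2_apply, E3_apply,
    real_inner_comm, real_inner_comm _ (fderiv ℝ hopfAmb p (frame 2 p)),
    real_inner_comm _ (fderiv ℝ hopfAmb p (frame 1 p)),
    real_inner_comm _ (fderiv ℝ hopfAmb p (frame 2 p))]
  ring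

theorem hamField_eq_iff_grad : hamField ψ = hamField χ ↔ VF.grad ψ = VF.grad χ := by
  rw [eq_hamField_iff, ← eq_hamField_iff.1 (rfl : hamField ψ = hamField ψ), eq_comm]

end HopfPullback

/-- The orbit of `q` under the flow of `2 E₁`, which is the Hopf fibre through `q`. -/
def hopfFibre (q : Sph 3) (t : ℝ) : Sph 3 :=
  ⟨Real.cos t • (q : Amb 3) + Real.sin t • (2 : ℝ) • frame 0 q, by
    have hq : ⟪(q : Amb 3), frame 0 q⟫_ℝ = 0 := E1.inner_coe q
    have hE : ‖frame 0 (q : Amb 3)‖ ^ 2 = 1 / 4 := by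
      rw [← real_inner_self_eq_norm_sq, inner_frame]
      simp
    rw [mem_sphere_zero_iff_norm, ← sq_eq_sq₀ (norm_nonneg _) zero_le_one, norm_add_sq_real]
    simp only [norm_smul, mul_pow, real_inner_smul_left, real_inner_smul_right, hq, hE,
      norm_eq_of_mem_sphere, Real.norm_eq_abs, sq_abs]
    linear_combination Real.cos_sq_add_sin_sq t⟩

section Descent

variable {f : SmoothFun 3}

theorem hasDerivAt_hopfFibre (q : Sph 3) (t : ℝ) :
    HasDerivAt (fun t => (hopfFibre q t : Amb 3)) ((2 : ℝ) • E1.1 (hopfFibre q t)) t := by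
  have hsq : frame 0 (frame 0 (q : Amb 3)) = -((1 / 4 : ℝ) • (q : Amb 3)) := by
    ext i
    fin_cases i <;> simp [frame_zero] <;> ring
  refine (((Real.hasDerivAt_cos t).smul_const (q : Amb 3)).add
    ((Real.hasDerivAt_sin t).smul_const ((2 : ℝ) • frame 0 (q : Amb 3)))).congr_deriv ?_
  simp only [E1_apply, hopfFibre, map_add, map_smul, hsq]
  module

theorem apply_hopfFibre_of_lie_E1_eq_zero (hf : ⁅E1, f⁆ = 0) (q : Sph 3) (t : ℝ) :
    f (hopfFibre q t) = f q := by
  have hd (t : ℝ) : HasDerivAt (fun t => f (hopfFibre q t)) 0 t := by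
    have h := (VF.differentiableAt_fun f (hopfFibre q t)).hasFDerivAt.comp_hasDerivAt t
      (hasDerivAt_hopfFibre q t)
    simp only [← VF.ext0_coe, map_smul, ← VF.lie_fun_apply, hf] at h
    simpa [Function.comp_def, radialExt_coe] using h
  have h := is_const_of_deriv_eq_zero (fun t => (hd t).differentiableAt) (fun t => (hd t).deriv) t 0
  rw [h]
  congr 1
  ext1
  simp [hopfFibre]

theorem radialExt_cone_hopfFibre (hf : ⁅E1, f⁆ = 0) (q : Sph 3) {a b : ℝ}
    (h : a • (q : Amb 3) + b • (2 : ℝ) • frame 0 q ≠ 0) :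
    radialExt f (a • (q : Amb 3) + b • (2 : ℝ) • frame 0 q) = f q := by
  let z : ℂ := ⟨a, b⟩
  have hz : z ≠ 0 := fun hz => h (by
    rw [show a = 0 from congrArg Complex.re hz, show b = 0 from congrArg Complex.im hz]
    simp)
  have ha : a = ‖z‖ * Real.cos z.arg := (Complex.norm_mul_cos_arg z).symm
  have hb : b = ‖z‖ * Real.sin z.arg := (Complex.norm_mul_sin_arg z).symm
  rw [ha, hb, mul_smul, mul_smul _ (Real.sin _), ← smul_add, radialExt_smul _ (norm_pos_iff.2 hz)]
  exact (radialExt_coe f (hopfFibre q z.arg)).trans (apply_hopfFibre_of_lie_E1_eq_zero hf q _)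

end Descent

section HopfSection

/-- A section of the cone over the Hopf map, vanishing only over the ray through `(-1, 0, 0)`. -/
def hopfSection₁ (y : Amb 2) : Amb 3 := !₂[1 + y 0, y 1, y 2, 0]

/-- A section of the cone over the Hopf map, vanishing only over the ray through `(1, 0, 0)`. -/
def hopfSection₂ (y : Amb 2) : Amb 3 := !₂[y 2, 0, 1 - y 0, -y 1]

theorem contDiff_hopfSection₁ : ContDiff ℝ ∞ hopfSection₁ := by
  rw [contDiff_euclidean]
  intro i
  fin_cases i <;> simp only [hopfSection₁] <;> dsimp <;> fun_prop

theorem contDiff_hopfSection₂ : ContDiff ℝ ∞ hopfSection₂ := by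
  rw [contDiff_euclidean]
  intro i
  fin_cases i <;> simp only [hopfSection₂] <;> dsimp <;> fun_prop

theorem sum_sq_sph2 (p : Sph 2) :
    (p : Amb 2) 0 ^ 2 + (p : Amb 2) 1 ^ 2 + (p : Amb 2) 2 ^ 2 = 1 := by
  have h := EuclideanSpace.real_norm_sq_eq (p : Amb 2)
  rw [norm_eq_of_mem_sphere, one_pow, Fin.sum_univ_three] at h
  exact h.symm

theorem sum_sq_sph3 (q : Sph 3) :
    (q : Amb 3) 0 ^ 2 + (q : Amb 3) 1 ^ 2 + (q : Amb 3) 2 ^ 2 + (q : Amb 3) 3 ^ 2 = 1 := by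
  rw [← norm_sq_amb3, norm_eq_of_mem_sphere, one_pow]

theorem hopfSection₁_hopf (q : Sph 3) : hopfSection₁ (hopf q) =
    (2 * (q : Amb 3) 0) • (q : Amb 3) + (2 * (q : Amb 3) 3) • (2 : ℝ) • frame 0 q := by
  ext i
  fin_cases i <;> simp only [hopf_coe, hopfSection₁, hopfAmb, frame_zero] <;> dsimp
  · linear_combination -sum_sq_sph3 q
  all_goals ring

theorem hopfSection₂_hopf (q : Sph 3) : hopfSection₂ (hopf q) =
    (2 * (q : Amb 3) 2) • (q : Amb 3) + (2 * (q : Amb 3) 1) • (2 : ℝ) • frame 0 q := by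
  ext i
  fin_cases i <;> simp only [hopf_coe, hopfSection₂, hopfAmb, frame_zero] <;> dsimp
  · ring
  · ring
  · linear_combination -sum_sq_sph3 q
  · ring

theorem hopfAmb_hopfSection₁ (p : Sph 2) :
    hopfAmb (hopfSection₁ p) = ‖hopfSection₁ p‖ ^ 2 • (p : Amb 2) := by
  rw [norm_sq_amb3]
  ext i
  fin_cases i <;> simp only [hopfSection₁, hopfAmb] <;> dsimp
  · linear_combination (-1 - (p : Amb 2) 0) * sum_sq_sph2 p
  · linear_combination (-(p : Amb 2) 1) * sum_sq_sph2 p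
  · linear_combination (-(p : Amb 2) 2) * sum_sq_sph2 p

theorem hopfAmb_hopfSection₂ (p : Sph 2) :
    hopfAmb (hopfSection₂ p) = ‖hopfSection₂ p‖ ^ 2 • (p : Amb 2) := by
  rw [norm_sq_amb3]
  ext i
  fin_cases i <;> simp only [hopfSection₂, hopfAmb] <;> dsimp
  · linear_combination (1 - (p : Amb 2) 0) * sum_sq_sph2 p
  · linear_combination (-(p : Amb 2) 1) * sum_sq_sph2 p
  · linear_combination (-(p : Amb 2) 2) * sum_sq_sph2 p

theorem hopfSection₁_ne_zero_or_hopfSection₂_ne_zero (y : Amb 2) :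
    hopfSection₁ y ≠ 0 ∨ hopfSection₂ y ≠ 0 := by
  by_contra! h
  have h₁ : 1 + y 0 = 0 := congrArg (fun v : Amb 3 => v 0) h.1
  have h₂ : 1 - y 0 = 0 := congrArg (fun v : Amb 3 => v 2) h.2
  linarith

theorem hopfAmb_smul (c : ℝ) (y : Amb 3) : hopfAmb (c • y) = c ^ 2 • hopfAmb y := by
  ext i
  fin_cases i <;> simp [hopfAmb] <;> ring

theorem exists_hopf_eq {p : Sph 2} {s : Amb 3} (hs : s ≠ 0)
    (h : hopfAmb s = ‖s‖ ^ 2 • (p : Amb 2)) : ∃ q, hopf q = p := by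
  obtain ⟨q, hq, -⟩ := exists_radial ℝ hs
  refine ⟨q, Subtype.ext ?_⟩
  rw [hopf_coe, hq, hopfAmb_smul, h, smul_smul, ← mul_pow, inv_mul_cancel₀ (norm_ne_zero_iff.2 hs),
    one_pow, one_smul]

theorem hopf_surjective : Function.Surjective hopf := fun p =>
  (hopfSection₁_ne_zero_or_hopfSection₂_ne_zero p).elim
    (fun h => exists_hopf_eq h (hopfAmb_hopfSection₁ p))
    fun h => exists_hopf_eq h (hopfAmb_hopfSection₂ p)

theorem hopfPullback_injective : Function.Injective hopfPullback := fun f h e =>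
  ContMDiffMap.ext fun p => by
    obtain ⟨q, rfl⟩ := hopf_surjective p
    exact DFunLike.congr_fun e q

end HopfSection

section Descent

variable {f : SmoothFun 3}

theorem radialExt_hopfSection₁_hopf (hf : ⁅E1, f⁆ = 0) {q : Sph 3}
    (h : hopfSection₁ (hopf q) ≠ 0) : radialExt f (hopfSection₁ (hopf q)) = f q := by
  rw [hopfSection₁_hopf] at h ⊢
  exact radialExt_cone_hopfFibre hf q h

theorem radialExt_hopfSection₂_hopf (hf : ⁅E1, f⁆ = 0) {q : Sph 3}
    (h : hopfSection₂ (hopf q) ≠ 0) : radialExt f (hopfSection₂ (hopf q)) = f q := by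
  rw [hopfSection₂_hopf] at h ⊢
  exact radialExt_cone_hopfFibre hf q h

theorem eq_of_hopf_eq (hf : ⁅E1, f⁆ = 0) {q q' : Sph 3} (h : hopf q = hopf q') : f q = f q' := by
  rcases hopfSection₁_ne_zero_or_hopfSection₂_ne_zero (hopf q) with hs | hs
  · rw [← radialExt_hopfSection₁_hopf hf hs, h, radialExt_hopfSection₁_hopf hf (h ▸ hs)]
  · rw [← radialExt_hopfSection₂_hopf hf hs, h, radialExt_hopfSection₂_hopf hf (h ▸ hs)]

theorem contMDiffAt_of_eq_radialExt {m n : ℕ} {f : SmoothFun m} {g : Sph n → ℝ} {s : Amb n → Amb m}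
    (hs : ContDiff ℝ ∞ s) (hg : ∀ p : Sph n, s p ≠ 0 → g p = radialExt f (s p)) {p : Sph n}
    (hp : s p ≠ 0) : ContMDiffAt (𝓡 n) 𝓘(ℝ, ℝ) ∞ g p := by
  have := Fact.mk (@finrank_euclideanSpace_fin ℝ _ (n + 1))
  have hsmooth : ContDiffAt ℝ ∞ (fun y => radialExt f (s y)) p :=
    ContDiffAt.comp (p : Amb n) (VF.smooth_fun f hp) hs.contDiffAt
  have hrestrict : ContMDiffAt (𝓡 n) 𝓘(ℝ, ℝ) ∞ (fun p : Sph n => radialExt f (s p)) p :=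
    ContMDiffAt.comp p hsmooth.contMDiffAt (contMDiff_coe_sphere p)
  have hopen : IsOpen {p : Sph n | s p ≠ 0} :=
    isOpen_ne.preimage (hs.continuous.comp continuous_subtype_val)
  exact hrestrict.congr_of_eventuallyEq (Filter.eventually_of_mem (hopen.mem_nhds hp) hg)

theorem exists_hopfPullback_eq (hf : ⁅E1, f⁆ = 0) : ∃ g : SmoothFun 2, hopfPullback g = f := by
  let g : Sph 2 → ℝ := fun p => f (Function.surjInv hopf_surjective p)
  have hg (q : Sph 3) : g (hopf q) = f q :=
    eq_of_hopf_eq hf (Function.surjInv_eq hopf_surjective (hopf q))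
  refine ⟨⟨g, fun p => ?_⟩, ContMDiffMap.ext hg⟩
  rcases hopfSection₁_ne_zero_or_hopfSection₂_ne_zero p with hp | hp
  · refine contMDiffAt_of_eq_radialExt (f := f) contDiff_hopfSection₁ (fun p hp => ?_) hp
    obtain ⟨q, rfl⟩ := hopf_surjective p
    exact (hg q).trans (radialExt_hopfSection₁_hopf hf hp).symm
  · refine contMDiffAt_of_eq_radialExt (f := f) contDiff_hopfSection₂ (fun p hp => ?_) hp
    obtain ⟨q, rfl⟩ := hopf_surjective p
    exact (hg q).trans (radialExt_hopfSection₂_hopf hf hp).symm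

end Descent

section Poisson

variable (f g h ψ χ : SmoothFun 2)

theorem hopfPullback_add : hopfPullback (f + g) = hopfPullback f + hopfPullback g := rfl

theorem hopfPullback_smul (c : ℝ) : hopfPullback (c • f) = c • hopfPullback f := rfl

theorem hopfPullback_neg : hopfPullback (-f) = -hopfPullback f := rfl

theorem hopfPullback_sub : hopfPullback (f - g) = hopfPullback f - hopfPullback g := rfl

theorem poisson_jacobi :
    poisson f (poisson g h) = poisson (poisson f g) h + poisson g (poisson f h) := by
  apply hopfPullback_injective
  rw [hopfPullback_add]
  simp only [hopfPullback_poisson, lie_sub, VF.lie_mul, lie_E3_lie_E2, lie_E1_hopfPullback,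
    add_zero]
  ring

theorem lie_hamField_hamField : ⁅hamField f, hamField g⁆ = hamField (poisson f g) := by
  refine VF.ext_of_lie fun σ => ?_
  rw [lie_lie, lie_hamField, lie_hamField, lie_hamField, lie_hamField, lie_hamField, poisson_jacobi,
    add_sub_cancel_right]

theorem hamField_add : hamField (ψ + χ) = hamField ψ + hamField χ := by
  refine VF.ext_of_lie fun σ => ?_
  rw [add_lie, lie_hamField, lie_hamField, lie_hamField, ← poisson_skew, ← poisson_skew ψ,
    ← poisson_skew χ, ← lie_hamField, lie_add, lie_hamField, lie_hamField, neg_add]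

theorem hamField_smul (c : ℝ) : hamField (c • ψ) = c • hamField ψ := by
  refine VF.ext_of_lie fun σ => ?_
  rw [smul_lie, lie_hamField, lie_hamField, ← poisson_skew, ← poisson_skew ψ, ← lie_hamField,
    lie_smul, lie_hamField, smul_neg]

variable {ψ χ} in
theorem hamField_eq_iff : hamField ψ = hamField χ ↔
    ⁅E2, hopfPullback ψ⁆ = ⁅E2, hopfPullback χ⁆ ∧ ⁅E3, hopfPullback ψ⁆ = ⁅E3, hopfPullback χ⁆ := by
  constructor
  · intro h
    have hlie (X : VF 3) : ⁅X, hopfPullback ψ⁆ = ⁅X, hopfPullback χ⁆ :=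
      ContMDiffMap.ext fun p => by
        rw [lie_hopfPullback, lie_hopfPullback, (hamField_eq_iff_grad ψ χ).1 h]
    exact ⟨hlie E2, hlie E3⟩
  · rintro ⟨h₂, h₃⟩
    refine VF.ext_of_lie fun σ => hopfPullback_injective ?_
    rw [lie_hamField, lie_hamField, hopfPullback_poisson, hopfPullback_poisson, h₂, h₃]

variable {ψ χ} in
theorem poisson_congr (h : hamField ψ = hamField χ) (σ : SmoothFun 2) :
    poisson ψ σ = poisson χ σ := by
  rw [← lie_hamField, h, lie_hamField]

end Poisson

section Stream

/-- The linear map `ψ ↦ X_ψ` onto the divergence-free vector fields on `S²`. -/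
def hamLinear : SmoothFun 2 →ₗ[ℝ] divFree 2 where
  toFun ψ := ⟨hamField ψ, mem_divFree_two_iff.2 ⟨ψ, rfl⟩⟩
  map_add' ψ χ := Subtype.ext (hamField_add ψ χ)
  map_smul' c ψ := Subtype.ext (hamField_smul ψ c)

theorem hamLinear_surjective : Function.Surjective hamLinear := fun v =>
  (mem_divFree_two_iff.1 v.2).imp fun _ h => Subtype.ext h.symm

/-- A linear choice of stream functions for divergence-free vector fields on `S²`. -/
def stream : divFree 2 →ₗ[ℝ] SmoothFun 2 :=
  (hamLinear.exists_rightInverse_of_surjective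
    (LinearMap.range_eq_top.2 hamLinear_surjective)).choose

theorem hamField_stream (v : divFree 2) : hamField (stream v) = v :=
  congrArg Subtype.val (LinearMap.congr_fun (hamLinear.exists_rightInverse_of_surjective
    (LinearMap.range_eq_top.2 hamLinear_surjective)).choose_spec v)

theorem hamField_stream_lie (v w : divFree 2) :
    hamField (stream ⁅v, w⁆) = hamField (poisson (stream v) (stream w)) := by
  rw [hamField_stream, ← lie_hamField_hamField, hamField_stream, hamField_stream]
  rfl

theorem divFree_lie_eq {v : divFree 2} {ψ : SmoothFun 2} (hv : (v : VF 2) = hamField ψ)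
    (σ : SmoothFun 2) : ⁅v, σ⁆ = poisson ψ σ := by
  rw [← lie_hamField, ← hv]
  rfl

theorem divFree_lie (v : divFree 2) (σ : SmoothFun 2) : ⁅v, σ⁆ = poisson (stream v) σ :=
  divFree_lie_eq (hamField_stream v).symm σ

end Stream

section Cocycle

/-- The alternating form `b(X_ψ, X_χ) = -{ψ, χ}`, written as `b(v, w) = -v(χ)` for a stream function
`χ` of `w`. -/
def hopfCochain : LieModule.Cohomology.twoCochain ℝ (divFree 2) (SmoothFun 2) :=
  ⟨LinearMap.mk₂ ℝ (fun v w => -⁅v, stream w⁆)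
    (fun v v' w => by rw [add_lie, neg_add]) (fun c v w => by rw [smul_lie, smul_neg])
    (fun v w w' => by rw [map_add, lie_add, neg_add])
    (fun c v w => by rw [map_smul, lie_smul, smul_neg]),
  fun v => by rw [LinearMap.mk₂_apply, divFree_lie, poisson_self, neg_zero]⟩

theorem hopfCochain_apply (v w : divFree 2) :
    hopfCochain v w = -poisson (stream v) (stream w) :=
  congrArg Neg.neg (divFree_lie v (stream w))

theorem hopfCochain_mem_twoCocycle :
    hopfCochain ∈ LieModule.Cohomology.twoCocycle ℝ (divFree 2) (SmoothFun 2) := by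
  rw [LieModule.Cohomology.mem_twoCocycle_iff]
  ext1 u
  ext1 v
  ext1 w
  rw [LieModule.Cohomology.d₂₃_apply, LinearMap.zero_apply, LinearMap.zero_apply,
    LinearMap.zero_apply]
  simp only [hopfCochain_apply, lie_neg, divFree_lie, poisson_congr (hamField_stream_lie _ _)]
  rw [← poisson_skew (poisson _ _) (stream u), ← poisson_skew (poisson _ _) (stream v),
    ← poisson_skew (poisson _ _) (stream w), poisson_jacobi (stream u) (stream v) (stream w),
    ← poisson_skew (poisson (stream u) (stream v)) (stream w)]
  abel

/-- The 2-cocycle `b` on `𝔛_μ(S²)` with values in `C^∞(S²)`. -/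
def hopfCocycle : LieModule.Cohomology.twoCocycle ℝ (divFree 2) (SmoothFun 2) :=
  ⟨hopfCochain, hopfCochain_mem_twoCocycle⟩

theorem hopfCocycle_apply {v w : divFree 2} {ψ χ : SmoothFun 2} (hv : (v : VF 2) = hamField ψ)
    (hw : (w : VF 2) = hamField χ) : hopfCocycle.1.1 v w = -poisson ψ χ := by
  refine (hopfCochain_apply v w).trans (congrArg Neg.neg ?_)
  rw [poisson_congr ((hamField_stream v).trans hv), ← poisson_skew, ← poisson_skew ψ,
    poisson_congr ((hamField_stream w).trans hw)]

end Cocycle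

section FormField

theorem formField_lie (σ ψ f : SmoothFun 3) : ⁅formField σ ψ, f⁆ =
    σ * ⁅E1, f⁆ + (⁅E2, ψ⁆ * ⁅E3, f⁆ - ⁅E3, ψ⁆ * ⁅E2, f⁆) := by
  rw [formField, frameField_lie]
  ring

theorem formField_add (σ τ ψ χ : SmoothFun 3) :
    formField (σ + τ) (ψ + χ) = formField σ ψ + formField τ χ := by
  refine VF.ext_of_lie fun f => ?_
  simp only [add_lie, formField_lie, lie_add]
  ring

theorem formField_smul (c : ℝ) (σ ψ : SmoothFun 3) :
    formField (c • σ) (c • ψ) = c • formField σ ψ := by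
  refine VF.ext_of_lie fun f => ?_
  simp only [smul_lie, formField_lie, lie_smul, smul_mul_assoc, smul_add, smul_sub]

theorem lie_formField {σ τ ψ χ : SmoothFun 3} (hψ : ⁅E1, ψ⁆ = 0) (hχ : ⁅E1, χ⁆ = 0) :
    ⁅formField σ ψ, formField τ χ⁆ = formField
      (⁅formField σ ψ, τ⁆ - ⁅formField τ χ, σ⁆ - (⁅E2, ψ⁆ * ⁅E3, χ⁆ - ⁅E3, ψ⁆ * ⁅E2, χ⁆))
      (⁅E2, ψ⁆ * ⁅E3, χ⁆ - ⁅E3, ψ⁆ * ⁅E2, χ⁆) := by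
  refine VF.ext_of_lie fun f => ?_
  rw [lie_lie]
  simp only [formField_lie, lie_sub, lie_add, VF.lie_mul, lie_E1_lie_E2, lie_E1_lie_E3,
    lie_E3_lie_E2, hψ, hχ, lie_zero]
  ring

end FormField

section HopfLift

theorem formField_hopfPullback_eq_iff {σ τ ψ χ : SmoothFun 2} :
    formField (hopfPullback σ) (hopfPullback ψ) = formField (hopfPullback τ) (hopfPullback χ) ↔
      σ = τ ∧ hamField ψ = hamField χ := by
  rw [formField, formField, frameField_inj, neg_inj, hopfPullback_injective.eq_iff, hamField_eq_iff,
    and_comm (a := ⁅E3, hopfPullback ψ⁆ = _)]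

theorem formField_hopfPullback_lie (σ ψ τ : SmoothFun 2) :
    ⁅formField (hopfPullback σ) (hopfPullback ψ), hopfPullback τ⁆ = hopfPullback (poisson ψ τ) := by
  rw [formField_lie, lie_E1_hopfPullback, mul_zero, zero_add, hopfPullback_poisson]

theorem lie_formField_hopfPullback (σ τ ψ χ : SmoothFun 2) :
    ⁅formField (hopfPullback σ) (hopfPullback ψ), formField (hopfPullback τ) (hopfPullback χ)⁆ =
      formField (hopfPullback (-poisson ψ χ + poisson ψ τ - poisson χ σ))
        (hopfPullback (poisson ψ χ)) := by
  rw [lie_formField (lie_E1_hopfPullback ψ) (lie_E1_hopfPullback χ), formField_hopfPullback_lie,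
    formField_hopfPullback_lie, ← hopfPullback_poisson, hopfPullback_sub, hopfPullback_add,
    hopfPullback_neg]
  congr 1
  abel

/-- The isomorphism from the extension to `𝔛¹_μ(S³)`, `(X_ψ, σ) ↦ formField (π^* σ) (π^* ψ)`. -/
def hopfLift : LieAlgebra.ofTwoCocycle hopfCocycle →ₗ⁅ℝ⁆ hopfDivFree where
  toFun x := ⟨formField (hopfPullback x.carrier.2) (hopfPullback (stream x.carrier.1)),
    mem_hopfDivFree_iff.2 ⟨_, _, lie_E1_hopfPullback _, lie_E1_hopfPullback _, hasForm_iff.2 rfl⟩⟩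
  map_add' x y := Subtype.ext <| by
    change formField (hopfPullback (x.carrier.2 + y.carrier.2))
      (hopfPullback (stream (x.carrier.1 + y.carrier.1))) = formField _ _ + formField _ _
    rw [map_add, hopfPullback_add, hopfPullback_add, formField_add]
  map_smul' c x := Subtype.ext <| by
    change formField (hopfPullback (c • x.carrier.2)) (hopfPullback (stream (c • x.carrier.1))) =
      c • formField _ _
    rw [map_smul, hopfPullback_smul, hopfPullback_smul, formField_smul]
  map_lie' {x y} := Subtype.ext <| by
    change formField (hopfPullback (hopfCochain x.carrier.1 y.carrier.1 + ⁅x.carrier.1, y.carrier.2⁆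
        - ⁅y.carrier.1, x.carrier.2⁆)) (hopfPullback (stream ⁅x.carrier.1, y.carrier.1⁆)) =
      ⁅formField _ _, formField _ _⁆
    rw [lie_formField_hopfPullback, hopfCochain_apply, divFree_lie, divFree_lie]
    exact formField_hopfPullback_eq_iff.2 ⟨rfl, hamField_stream_lie _ _⟩

theorem hopfLift_eq_iff (x : LieAlgebra.ofTwoCocycle hopfCocycle) {v : divFree 2}
    {σ ψ : SmoothFun 2} (hv : (v : VF 2) = hamField ψ) :
    x = LieAlgebra.ofProd hopfCocycle (v, σ) ↔
      HasForm (hopfLift x : VF 3) (hopfPullback σ) (hopfPullback ψ) := by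
  obtain ⟨⟨w, τ⟩, rfl⟩ := (LieAlgebra.ofProd hopfCocycle).surjective x
  have hlift : (hopfLift (LieAlgebra.ofProd hopfCocycle (w, τ)) : VF 3) =
    formField (hopfPullback τ) (hopfPullback (stream w)) := rfl
  rw [hasForm_iff, hlift, formField_hopfPullback_eq_iff, hamField_stream, ← hv,
    (LieAlgebra.ofProd hopfCocycle).injective.eq_iff, Prod.mk.injEq, and_comm, Subtype.ext_iff]

theorem hopfLift_injective : Function.Injective hopfLift := fun x y h =>
  have hv := (hamField_stream y.carrier.1).symm
  (hopfLift_eq_iff x hv).2 (h ▸ (hopfLift_eq_iff y (σ := y.carrier.2) hv).1 rfl)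

theorem hopfLift_surjective : Function.Surjective hopfLift := by
  intro u
  obtain ⟨σ', ψ', hσ, hψ, hu⟩ := mem_hopfDivFree_iff.1 u.2
  obtain ⟨σ, rfl⟩ := exists_hopfPullback_eq hσ
  obtain ⟨ψ, rfl⟩ := exists_hopfPullback_eq hψ
  let x := LieAlgebra.ofProd hopfCocycle (hamLinear ψ, σ)
  have hx := (hopfLift_eq_iff x (v := hamLinear ψ) rfl).1 rfl
  exact ⟨x, Subtype.ext ((hasForm_iff.1 hx).trans (hasForm_iff.1 hu).symm)⟩

/-- The isomorphism `𝔛¹_μ(S³) ≃ 𝔛_μ(S²) × C^∞(S²)` inverse to `hopfLift`. -/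
def hopfEquiv : hopfDivFree ≃ₗ⁅ℝ⁆ LieAlgebra.ofTwoCocycle hopfCocycle :=
  (LieEquiv.ofBijective hopfLift ⟨hopfLift_injective, hopfLift_surjective⟩).symm

theorem hopfEquiv_eq_iff (u : hopfDivFree) {v : divFree 2} {σ ψ : SmoothFun 2}
    (hv : (v : VF 2) = hamField ψ) :
    hopfEquiv u = LieAlgebra.ofProd hopfCocycle (v, σ) ↔
      HasForm u (hopfPullback σ) (hopfPullback ψ) := by
  rw [hopfLift_eq_iff (hopfEquiv u) hv]
  exact iff_of_eq (congrArg (fun u : hopfDivFree => HasForm u _ _)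
    ((LieEquiv.ofBijective hopfLift ⟨hopfLift_injective, hopfLift_surjective⟩).apply_symm_apply u))

end HopfLift

end SphereFlow

end

theorem mainTheorem4 :
    -- `𝔛_μ(S²)` consists of the fields `X_ψ`, and it acts on `C^∞(S²)` by `ρ(X_ψ) σ = {ψ, σ}`
    (∀ v : VF 2, v ∈ divFree 2 ↔ ∃ ψ : SmoothFun 2, v = hamField ψ) ∧
    (∀ (v : divFree 2) (ψ σ : SmoothFun 2), (v : VF 2) = hamField ψ → ⁅v, σ⁆ = poisson ψ σ) ∧
    -- the `E₁`-invariant functions on `S³` are the pullbacks of functions on `S²`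
    (∀ f' : SmoothFun 3, ⁅E1, f'⁆ = 0 ↔ ∃ f : SmoothFun 2, hopfPullback f = f') ∧
    Function.Injective hopfPullback ∧
    -- every `u ∈ 𝔛¹_μ(S³)` is given by two `E₁`-invariant functions
    (∀ u : VF 3, u ∈ hopfDivFree ↔
      ∃ σ' ψ' : SmoothFun 3, ⁅E1, σ'⁆ = 0 ∧ ⁅E1, ψ'⁆ = 0 ∧ HasForm u σ' ψ') ∧
    -- `b(X_ψ₁, X_ψ₂) = -{ψ₁, ψ₂}` is a 2-cocycle `b`, and the Abelian extension
    -- of `𝔛_μ(S²)` by `C^∞(S²)` that it defines is isomorphic to `𝔛¹_μ(S³)`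
    ∃ b : LieModule.Cohomology.twoCocycle ℝ (divFree 2) (SmoothFun 2),
      (∀ (v₁ v₂ : divFree 2) (ψ₁ ψ₂ : SmoothFun 2),
        (v₁ : VF 2) = hamField ψ₁ → (v₂ : VF 2) = hamField ψ₂ →
          b.1.1 v₁ v₂ = -poisson ψ₁ ψ₂) ∧
      ∃ Φ : hopfDivFree ≃ₗ⁅ℝ⁆ LieAlgebra.ofTwoCocycle b,
        ∀ (u : hopfDivFree) (v : divFree 2) (σ ψ : SmoothFun 2), (v : VF 2) = hamField ψ →
          (Φ u = LieAlgebra.ofProd b (v, σ) ↔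
            HasForm u (hopfPullback σ) (hopfPullback ψ)) := by
  refine ⟨fun v => mem_divFree_two_iff, fun v ψ σ hv => divFree_lie_eq hv σ,
    fun f' => ⟨exists_hopfPullback_eq, ?_⟩, hopfPullback_injective, fun u => mem_hopfDivFree_iff,
    hopfCocycle, fun v₁ v₂ ψ₁ ψ₂ h₁ h₂ => hopfCocycle_apply h₁ h₂,
    hopfEquiv, fun u v σ ψ hv => hopfEquiv_eq_iff u hv⟩
  rintro ⟨f, rfl⟩
  exact lie_E1_hopfPullback f
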